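/- Let $K\ge 2$ and $\lambda>0$, and put $\Sigma=\{1,\dots,K\}$, $p_+=\frac{e^\lambda}{e^\lambda+K-1}$, $p_-=\frac{1}{e^\lambda+K-1}$. For a horizon $H$, a generator $M$ assigns to each prompt $x$ and prefix $p\in\Sigma^{<H}$ a distribution $M(\cdot\mid x,p)$ on $\Sigma$, and $M(y\mid x)=\prod_{t\le H}M(y_t\mid x,y_{<t})$ for $y\in\Sigma^H$. For a prompt distribution $\rho$, a reward $r$ and $\beta>0$, the objective of a prompt-conditioned policy $\pi$ is $$J_\beta(\pi)=\mathbb E_{x\sim\rho}\bigl[\mathbb E_{y\sim\pi(\cdot\mid x)}r(x,y)-\beta\,\mathrm{KL}(\pi(\cdot\mid x)\,\|\,M(\cdot\mid x))\bigr],$$ an exact optimizer is a maximizer of $J_\beta$ over all policies, and the average regret of $\pi$ is $\sup_{\pi'}J_\beta(\pi')-J_\beta(\pi)$. Hard family. Let $H=D+L+1$ with $D,L\ge1$, let $x^\star$ be a prompt with mass $\eta=\rho(\{x^\star\})>0$, let $v\in\Sigma^D$, let $\tau_0\ne\tau_1$ in $\Sigma$, and let $M_{\mathrm{easy}}$ be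 a generator. For $s\in\Sigma^L$, $b\in\{0,1\}$ the instance $(s,b)$ has base generator $Q_s$ and reward $r_{s,b}$, where $Q_s=M_{\mathrm{easy}}$ at prompts $x\ne x^\star$; at $x^\star$, with $u=vs$, $Q_s(a\mid x^\star,u_{<t})$ is $p_+$ if $a=u_t$ and $p_-$ otherwise for $1\le t\le D+L$, and $Q_s(\cdot\mid x^\star,p)$ is uniform for every other prefix $p$; and $r_{s,b}(x,y)=R\,\mathbb 1\{x=x^\star,\ y=vs\tau_b\}$ with $R=\beta\log(4/q_0)$, $q_0=p_+^{D+L}/K$. Access. Algorithms are randomized and adaptive (a random seed and measurable decision rules), make finitely many queries, may interleave generator and reward queries, and output a policy. A reward query chooses a prompt $x$ and a policy $\pi$, and observes a sample $y\sim\pi(\cdot\mid x)$ and its reward $r(x,y)$. A chosen-prefix sampling query $(x,p)$ returns a draw from $M(\cdot\mid x,p)$; under the local-reset discipline, at each prompt, every queried prefix is empty, or was queried before, or extends a previously queried prefix by one token. A no-reset experiment is given by a Markov kernel $\Gamma$ not depending on the instance: a query $(x,q)$ draws $y\sim M(\cdot\mid x)$, forms $\mu_t=M(\cdot\mid x,y_{<t})$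 for $t\le H$, and returns a draw from $\Gamma_x(q,y,\mu_1,\dots,\mu_H)$. Claim. There are constants $c>1$ and $C,a>0$, depending only on $K$ and $\lambda$, such that for every $\beta>0$ and every integer $q_r\ge1$ there is $H_0$ such that for every $H\ge H_0$ there are $D,L\ge1$ with $D+L+1=H$ for which, for every prompt space with a distribution $\rho$, every prompt $x^\star$ with $\eta>0$, and all $v$, $\tau_0\neq\tau_1$, $M_{\mathrm{easy}}$, the hard family has the following two properties. 1. For every $\delta\in(0,1)$ there is an algorithm with chosen-prefix sampling access, obeying the local-reset discipline, that makes at most $C\,H\log(H/\delta)$ generator queries and at most one reward query and, on every instance $(s,b)$, outputs an exact optimizer with probability at least $1-\delta$. 2. For every no-reset experiment and every algorithm that accesses the generator only through it, makes at most $q_g$ generator queries and at most $q_r$ reward queries and, on every instance $(s,b)$, outputs with probability at least $2/3$ a policy of average regret at most $\eta\beta/4$, one has $q_g\ge a\,c^H$. -/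

import Mathlib

open MeasureTheory ProbabilityTheory
open scoped ENNReal

noncomputable section

namespace GenAccess

/-! ### Finite distributions, strings, generators -/

/-- `Δ(α)`: probability distributions on a finite set, with the Borel structure of `α → ℝ`. -/
abbrev ProbDist (α : Type*) [Fintype α] : Type _ := stdSimplex ℝ α

/-- The measure on `α` with mass function `w`. -/
def massMeasure {α : Type*} [Fintype α] [MeasurableSpace α] (w : α → ℝ) : Measure α :=
  ∑ a, ENNReal.ofReal (w a) • Measure.dirac a

/-- `Σ^H`, with the vocabulary `Σ` of size `K`. -/
abbrev Resp (K H : ℕ) : Type := Fin H → Fin K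

/-- `Σ^{<H}`: strings of length less than `H`. -/
def Prefix (K H : ℕ) : Type := {p : List (Fin K) // p.length < H}

instance (K H : ℕ) : MeasurableSpace (Prefix K H) := ⊤

instance (K H : ℕ) : DiscreteMeasurableSpace (Prefix K H) := ⟨fun _ => trivial⟩

instance (K H : ℕ) : Countable (Prefix K H) :=
  inferInstanceAs (Countable {p : List (Fin K) // p.length < H})

/-- `y_{<t}` for the position `t` (positions are numbered from `0`, so `y_{<t}` has length `t`). -/
def visited {K H : ℕ} (y : Resp K H) (t : Fin H) : Prefix K H :=
  ⟨(List.ofFn y).take t, by simp [List.length_take]⟩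

/-- A prompt-conditioned autoregressive generator `M(· | x, p)`. -/
structure Generator (X : Type*) [MeasurableSpace X] (K H : ℕ) where
  next : X → Prefix K H → ProbDist (Fin K)
  measurable_next : ∀ p, Measurable fun x => next x p

/-- `Pr_M(Y = y | x) = ∏_t M(y_t | x, y_{<t})`. -/
def Generator.respProb {X : Type*} [MeasurableSpace X] {K H : ℕ} (M : Generator X K H)
    (x : X) (y : Resp K H) : ℝ :=
  ∏ t : Fin H, (M.next x (visited y t)).1 (y t)

/-- A prompt-conditioned policy `π(· | x)`. -/
structure Policy (X : Type*) [MeasurableSpace X] (K H : ℕ) where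
  resp : X → ProbDist (Resp K H)
  measurable_resp : Measurable resp

/-! ### KL-regularized outcome-reward post-training -/

/-- A post-training instance: base generator and (bounded) outcome reward. -/
structure Instance (X : Type*) [MeasurableSpace X] (K H : ℕ) where
  base : Generator X K H
  reward : X → Resp K H → ℝ
  measurable_reward : ∀ y, Measurable fun x => reward x y
  bounded_reward : ∃ B : ℝ, ∀ x y, |reward x y| ≤ B

section Objective

variable {X : Type*} [MeasurableSpace X] {K H : ℕ}

/-- `J_β(π) = E_{x∼ρ}[E_{y∼π(·|x)} r(x,y) - β KL(π(·|x) ‖ M(·|x))]`, which is `-∞` when the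
averaged KL divergence is infinite. -/
def Instance.objective (I : Instance X K H) (ρ : Measure X) (β : ℝ) (π : Policy X K H) : EReal :=
  ((∫ x, ∑ y, (π.resp x).1 y * I.reward x y ∂ρ : ℝ) : EReal) -
    ((ENNReal.ofReal β * ∫⁻ x, InformationTheory.klDiv (massMeasure (π.resp x).1)
      (massMeasure (I.base.respProb x)) ∂ρ : ℝ≥0∞) : EReal)

/-- `π` is an exact optimizer of `J_β` among all prompt-conditioned policies. -/
def Instance.IsOptimizer (I : Instance X K H) (ρ : Measure X) (β : ℝ) (π : Policy X K H) : Prop :=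
  ∀ π' : Policy X K H, I.objective ρ β π' ≤ I.objective ρ β π

/-- The average regret `sup_{π'} J_β(π') - J_β(π)`. -/
def Instance.regret (I : Instance X K H) (ρ : Measure X) (β : ℝ) (π : Policy X K H) : EReal :=
  (⨆ π' : Policy X K H, I.objective ρ β π') - I.objective ρ β π

end Objective

/-! ### Oracles -/

theorem measurable_mixture {A B ι : Type*} [MeasurableSpace A] [MeasurableSpace B] [Fintype ι]
    {w : ι → A → ℝ} {κ : ι → A → Measure B} (hw : ∀ i, Measurable (w i))
    (hκ : ∀ i, Measurable (κ i)) :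
    Measurable fun a => ∑ i, ENNReal.ofReal (w i a) • κ i a := by
  refine Measure.measurable_of_measurable_coe _ fun s hs => ?_
  simp only [Measure.coe_finsetSum, Finset.sum_apply, Measure.smul_apply, smul_eq_mul]
  exact Finset.measurable_sum _ fun i _ =>
    (hw i).ennreal_ofReal.mul ((Measure.measurable_coe hs).comp (hκ i))

section Oracles

variable {X : Type*} [MeasurableSpace X] {K H : ℕ}

theorem Generator.measurable_next_prod (M : Generator X K H) :
    Measurable fun q : X × Prefix K H => M.next q.1 q.2 :=
  measurable_from_prod_countable_left fun p => M.measurable_next p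

/-- Chosen-prefix next-token sampling: the query `(x, p)` returns a draw from `M(· | x, p)`. -/
def prefixSample (M : Generator X K H) : Kernel (X × Prefix K H) (Fin K) where
  toFun q := massMeasure (M.next q.1 q.2).1
  measurable' := measurable_mixture
    (fun a => (measurable_pi_apply a).comp (measurable_subtype_coe.comp M.measurable_next_prod))
    (fun _ => measurable_const)

/-- A no-reset experiment with query space `Q`, reply space `Y` and reply kernel `Γ`: the query
`(x, q)` draws a rollout `y ∼ M(· | x)`, forms `μ_t = M(· | x, y_{<t})`, and draws the reply from
`Γ_x(q, y, μ_1, …, μ_H)`. The kernel `Γ` does not depend on `M`. -/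
def noReset {Q Y : Type*} [MeasurableSpace Q] [MeasurableSpace Y]
    (Γ : Kernel (X × Q × Resp K H × (Fin H → ProbDist (Fin K))) Y) (M : Generator X K H) :
    Kernel (X × Q) Y where
  toFun q := ∑ y : Resp K H, ENNReal.ofReal (M.respProb q.1 y) •
    Γ (q.1, q.2, y, fun t => M.next q.1 (visited y t))
  measurable' := by
    refine measurable_mixture (fun y => ?_) (fun y => Γ.measurable.comp ?_)
    · refine Finset.measurable_prod _ fun t _ => ?_
      exact (measurable_pi_apply (y t)).comp
        (measurable_subtype_coe.comp ((M.measurable_next (visited y t)).comp measurable_fst))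
    · refine measurable_fst.prodMk (measurable_snd.prodMk (measurable_const.prodMk ?_))
      exact measurable_pi_lambda _ fun t => (M.measurable_next (visited y t)).comp measurable_fst

/-- An outcome-reward query names a prompt `x` and the response distribution `π(· | x)` of a policy
at `x`; a completion `y ∼ π(· | x)` is sampled, and `y` and its reward `r(x, y)` are observed. -/
def rewardOracle (I : Instance X K H) : Kernel (X × ProbDist (Resp K H)) (Resp K H × ℝ) where
  toFun a := ∑ y : Resp K H, ENNReal.ofReal (a.2.1 y) • Measure.dirac (y, I.reward a.1 y)
  measurable' := measurable_mixture
    (fun y => (measurable_pi_apply y).comp (measurable_subtype_coe.comp measurable_snd))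
    (fun y => Measure.measurable_dirac.comp
      (measurable_const.prodMk ((I.measurable_reward y).comp measurable_fst)))

end Oracles

/-! ### Interactive algorithms -/

/-- What an algorithm does in one round: a generator query, a reward query, or no query. -/
abbrev Action (X GQ : Type*) (K H : ℕ) : Type _ := GQ ⊕ ((X × ProbDist (Resp K H)) ⊕ Unit)

/-- The reply received in one round. -/
abbrev Reply (GR : Type*) (K H : ℕ) : Type _ := GR ⊕ ((Resp K H × ℝ) ⊕ Unit)

/-- The reply to each possible action, given the generator oracle `G` and the reward oracle `R`. -/
def replyKernel {X GQ GR : Type*} [MeasurableSpace X] [MeasurableSpace GQ] [MeasurableSpace GR]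
    {K H : ℕ} (G : Kernel GQ GR) (R : Kernel (X × ProbDist (Resp K H)) (Resp K H × ℝ)) :
    Kernel (Action X GQ K H) (Reply GR K H) where
  toFun := Sum.elim (fun q => (G q).map Sum.inl)
    (Sum.elim (fun a => (R a).map fun o => Sum.inr (Sum.inl o))
      (fun _ => Measure.dirac (Sum.inr (Sum.inr ()))))
  measurable' := by
    refine Measurable.sumElim ((Measure.measurable_map _ measurable_inl).comp G.measurable)
      (Measurable.sumElim ((Measure.measurable_map _ ?_).comp R.measurable) measurable_const)
    exact measurable_inr.comp measurable_inl

/-- A randomized adaptive algorithm with random seed in `Ω`, generator queries in `GQ` and generator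
replies in `GR`: for finitely many rounds it acts on the seed and the replies received so far, and
finally it outputs a prompt-conditioned policy. Past actions are functions of the seed and of past
replies, so they need not be recorded. -/
structure Algorithm (Ω X GQ GR : Type*) [MeasurableSpace Ω] [MeasurableSpace X]
    [MeasurableSpace GQ] [MeasurableSpace GR] (K H : ℕ) where
  seedLaw : Measure Ω
  isProbabilityMeasure_seedLaw : IsProbabilityMeasure seedLaw
  rounds : ℕ
  act : (n : ℕ) → Ω × (Fin n → Reply GR K H) → Action X GQ K H
  measurable_act : ∀ n, Measurable (act n)
  output : (Ω × (Fin rounds → Reply GR K H)) × X → ProbDist (Resp K H)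
  measurable_output : Measurable output

namespace Algorithm

variable {Ω X GQ GR : Type*} [MeasurableSpace Ω] [MeasurableSpace X]
  [MeasurableSpace GQ] [MeasurableSpace GR] {K H : ℕ}

/-- The joint law of the seed and of the first `n` replies. -/
def lawUpTo (A : Algorithm Ω X GQ GR K H) (G : Kernel GQ GR)
    (R : Kernel (X × ProbDist (Resp K H)) (Resp K H × ℝ)) :
    (n : ℕ) → Measure (Ω × (Fin n → Reply GR K H))
  | 0 => A.seedLaw.map fun ω => (ω, Fin.elim0)
  | n + 1 => (A.lawUpTo G R n).bind fun τ =>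
      (replyKernel G R (A.act n τ)).map fun o => (τ.1, Fin.snoc τ.2 o)

/-- The joint law of the seed and of all replies. -/
def law (A : Algorithm Ω X GQ GR K H) (G : Kernel GQ GR)
    (R : Kernel (X × ProbDist (Resp K H)) (Resp K H × ℝ)) :
    Measure (Ω × (Fin A.rounds → Reply GR K H)) :=
  A.lawUpTo G R A.rounds

/-- The action taken in round `n` of a run. -/
def actionAt (A : Algorithm Ω X GQ GR K H) (τ : Ω × (Fin A.rounds → Reply GR K H))
    (n : Fin A.rounds) : Action X GQ K H :=
  A.act n (τ.1, fun i => τ.2 (Fin.castLE n.2.le i))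

/-- The policy output at the end of a run. -/
def policy (A : Algorithm Ω X GQ GR K H) (τ : Ω × (Fin A.rounds → Reply GR K H)) :
    Policy X K H where
  resp x := A.output (τ, x)
  measurable_resp := A.measurable_output.comp (measurable_const.prodMk measurable_id)

/-- The number of generator queries in a run. -/
def genCount (A : Algorithm Ω X GQ GR K H) (τ : Ω × (Fin A.rounds → Reply GR K H)) : ℕ :=
  Nat.card {n : Fin A.rounds // ∃ q, A.actionAt τ n = Sum.inl q}

/-- The number of reward queries in a run. -/
def rewardCount (A : Algorithm Ω X GQ GR K H) (τ : Ω × (Fin A.rounds → Reply GR K H)) : ℕ :=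
  Nat.card {n : Fin A.rounds // ∃ a, A.actionAt τ n = Sum.inr (Sum.inl a)}

/-- At most `g` generator queries and at most `r` reward queries, for every seed and every sequence
of replies. -/
def UsesAtMost (A : Algorithm Ω X GQ GR K H) (g r : ℕ) : Prop :=
  ∀ τ, A.genCount τ ≤ g ∧ A.rewardCount τ ≤ r

/-- The local-reset discipline, at each prompt: every queried prefix is the empty one, or was
queried before, or extends a previously queried prefix by one token. -/
def LocalReset (A : Algorithm Ω X (X × Prefix K H) GR K H) : Prop :=
  ∀ τ n x p, A.actionAt τ n = Sum.inl (x, p) → p.1 = [] ∨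
    ∃ m, m < n ∧ ∃ p', A.actionAt τ m = Sum.inl (x, p') ∧
      (p.1 = p'.1 ∨ ∃ a, p.1 = p'.1 ++ [a])

end Algorithm

/-! ### The hard family -/

/-- `p_+ = e^λ / (e^λ + K - 1)`. -/
def pPlus (K : ℕ) (lam : ℝ) : ℝ := Real.exp lam / (Real.exp lam + K - 1)

/-- `p_- = 1 / (e^λ + K - 1)`. -/
def pMinus (K : ℕ) (lam : ℝ) : ℝ := 1 / (Real.exp lam + K - 1)

theorem denom_pos {K : ℕ} (a : Fin K) (lam : ℝ) : 0 < Real.exp lam + K - 1 := by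
  have h : (1 : ℝ) ≤ K := by exact_mod_cast (Nat.succ_le_of_lt (Nat.zero_lt_of_lt a.2))
  linarith [Real.exp_pos lam]

/-- The next-token distribution with mass `p_+` at `a` and `p_-` at every other token. -/
def tilted {K : ℕ} (lam : ℝ) (a : Fin K) : ProbDist (Fin K) :=
  ⟨fun b => if b = a then pPlus K lam else pMinus K lam, by
    have hd := denom_pos a lam
    refine ⟨fun b => ?_, ?_⟩
    · simp only [pPlus, pMinus]
      split_ifs <;> positivity
    · have hK : 1 ≤ K := Nat.succ_le_of_lt (Nat.zero_lt_of_lt a.2)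
      rw [← Finset.add_sum_erase _ _ (Finset.mem_univ a), Finset.sum_congr rfl
        (fun b hb => if_neg (Finset.ne_of_mem_erase hb))]
      simp only [pPlus, pMinus, if_true, Finset.sum_const, Finset.card_erase_of_mem
        (Finset.mem_univ a), Finset.card_univ, Fintype.card_fin, nsmul_eq_mul, Nat.cast_sub hK]
      field_simp
      push_cast
      ring⟩

/-- The uniform next-token distribution. -/
def uniform (K : ℕ) [NeZero K] : ProbDist (Fin K) :=
  ⟨fun _ => 1 / K, fun _ => by positivity, by simp⟩

open scoped Classical in
/-- The next-token distributions of the hidden-path generator along `u`: at a proper prefix `u_{<t}`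
of `u` the token `u_t` is favored; every other prefix (`u` itself included) is uniform. -/
def hiddenPathNext {K H : ℕ} [NeZero K] (lam : ℝ) (u : List (Fin K)) (p : Prefix K H) :
    ProbDist (Fin K) :=
  if h : p.1 <+: u ∧ p.1.length < u.length then tilted lam (u[p.1.length]'h.2) else uniform K

section HardFamily

variable {X : Type*} [MeasurableSpace X] {K D L : ℕ} [NeZero K]

open scoped Classical in
/-- The base generator `Q_s`: the hidden path `v s` at the hard prompt, the fixed easy generator at
every other prompt. -/
def hardGenerator (lam : ℝ) {xs : X} (hxs : MeasurableSet {xs})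
    (easy : Generator X K (D + L + 1)) (v : Fin D → Fin K) (s : Fin L → Fin K) :
    Generator X K (D + L + 1) where
  next x p := if x = xs then hiddenPathNext lam (List.ofFn v ++ List.ofFn s) p else easy.next x p
  measurable_next p := Measurable.ite hxs measurable_const (easy.measurable_next p)

/-- The target completion `z_{s,b} = v s τ_b`. -/
def target (v : Fin D → Fin K) (τ : Bool → Fin K) (s : Fin L → Fin K) (b : Bool) :
    Resp K (D + L + 1) :=
  Fin.snoc (Fin.append v s) (τ b)

/-- The reward scale `R = β log (4 / q₀)`, where `q₀ = p_+^{D+L} / K` is the mass of the target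
completion under the base generator at the hard prompt. -/
def rewardScale (K D L : ℕ) (lam β : ℝ) : ℝ := β * Real.log (4 / (pPlus K lam ^ (D + L) / K))

open scoped Classical in
/-- The instance with hidden suffix `s` and reward bit `b`; its reward is
`r_{s,b}(x, y) = R 𝟙{x = x⋆, y = z_{s,b}}`. -/
def hardInstance (lam β : ℝ) {xs : X} (hxs : MeasurableSet {xs})
    (easy : Generator X K (D + L + 1)) (v : Fin D → Fin K) (τ : Bool → Fin K)
    (s : Fin L → Fin K) (b : Bool) : Instance X K (D + L + 1) where
  base := hardGenerator lam hxs easy v s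
  reward x y := if x = xs ∧ y = target v τ s b then rewardScale K D L lam β else 0
  measurable_reward y := by
    by_cases h : y = target v τ s b
    · simp only [h, and_true]
      exact Measurable.ite hxs measurable_const measurable_const
    · simp only [h, and_false, if_false]
      exact measurable_const
  bounded_reward := ⟨|rewardScale K D L lam β|, fun x y => by
    split_ifs
    · exact le_rfl
    · simp⟩

end HardFamily

end GenAccess

end

open GenAccess

/-! By the Gibbs variational principle, the maximizer of the objective is the base policy tilted by
`exp (r / β)`. On the instance `(s, b)` it is determined by `s` and `b`, and `R` is so large that a
policy of regret at most `η β / 4` must put mass more than `1 / 4` on the rewarded response.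

With local resets, the path `v s` is learned token by token: `N` draws at the prefix found so far,
followed by a plurality vote. A vote errs with probability at most `K * voteRate K lam ^ N` by an
exponential supermartingale built from the square root of the likelihood ratio. Once `s` is known,
the reward of a single query reveals `b`.

Without resets, the reply to a query differs from the reply on a fixed reference instance only if
the rollout follows the whole of `v`, which has probability `p₊ ^ D`. Summed over the `K ^ L`
suffixes, the `q_g` generator queries contribute at most `q_g * K ^ L * p₊ ^ D` to the total
variation, and a reward query contributes at most `1`, since the targets are distinct. No output
puts mass more than `1 / 4` on more than `4` targets, so `q_g` has to be of order `p₊ ^ (-D)`; for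
`D` about `H / 2` this is exponential in `H` with base `c = p₊ ^ (-1 / 2)`. -/

noncomputable section

namespace GenAccess

/-! ### Finite mixtures and Gibbs tilts -/

section Mixture

variable {ι B : Type*} [Fintype ι] [MeasurableSpace B]

theorem lintegral_mixture (w : ι → ℝ) (κ : ι → Measure B) (f : B → ℝ≥0∞) :
    ∫⁻ b, f b ∂(∑ i, ENNReal.ofReal (w i) • κ i) =
      ∑ i, ENNReal.ofReal (w i) * ∫⁻ b, f b ∂κ i := by
  simp only [lintegral_finsetSum_measure, lintegral_smul_measure, smul_eq_mul]

theorem sum_ofReal_probDist (w : ProbDist ι) : ∑ i, ENNReal.ofReal (w.1 i) = 1 := by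
  rw [← ENNReal.ofReal_sum_of_nonneg fun i _ => w.2.1 i, w.2.2, ENNReal.ofReal_one]

theorem isProbabilityMeasure_mixture (w : ProbDist ι) (κ : ι → Measure B)
    [∀ i, IsProbabilityMeasure (κ i)] :
    IsProbabilityMeasure (∑ i, ENNReal.ofReal (w.1 i) • κ i) :=
  ⟨by simpa only [Measure.coe_finsetSum, Finset.sum_apply, Measure.smul_apply, smul_eq_mul,
    measure_univ, mul_one] using sum_ofReal_probDist w⟩

end Mixture

section Gibbs

variable {α : Type*} [Fintype α]

/-- The partition function `∑ w e^f`. -/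
def partitionFn (w f : α → ℝ) : ℝ := ∑ a, w a * Real.exp (f a)

theorem partitionFn_pos (w : ProbDist α) (f : α → ℝ) : 0 < partitionFn w.1 f := by
  refine (Finset.sum_nonneg fun a _ => mul_nonneg (w.2.1 a) (Real.exp_pos _).le).lt_of_ne' ?_
  intro h
  have hzero : ∀ a, w.1 a = 0 := fun a => (mul_eq_zero.1 ((Finset.sum_eq_zero_iff_of_nonneg
    fun a _ => mul_nonneg (w.2.1 a) (Real.exp_pos _).le).1 h a (Finset.mem_univ a))).resolve_right
    (Real.exp_ne_zero _)
  simpa only [hzero, Finset.sum_const_zero, zero_ne_one] using w.2.2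

/-- The Gibbs tilt `w e^f / ∑ w e^f` of a distribution. -/
def gibbs (w : ProbDist α) (f : α → ℝ) : ProbDist α :=
  ⟨fun a => w.1 a * Real.exp (f a) / partitionFn w.1 f,
    fun a => div_nonneg (mul_nonneg (w.2.1 a) (Real.exp_pos _).le) (partitionFn_pos w f).le, by
    rw [← Finset.sum_div]
    exact div_self (partitionFn_pos w f).ne'⟩

variable [MeasurableSpace α]

theorem isProbabilityMeasure_massMeasure (w : ProbDist α) :
    IsProbabilityMeasure (massMeasure w.1) :=
  isProbabilityMeasure_mixture w _

variable [MeasurableSingletonClass α]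

theorem lintegral_massMeasure (w : α → ℝ) (f : α → ℝ≥0∞) :
    ∫⁻ a, f a ∂massMeasure w = ∑ a, ENNReal.ofReal (w a) * f a := by
  simp only [massMeasure, lintegral_mixture, lintegral_dirac]

theorem massMeasure_singleton (w : α → ℝ) (a : α) : massMeasure w {a} = ENNReal.ofReal (w a) := by
  classical
  rw [← lintegral_indicator_one (measurableSet_singleton a), lintegral_massMeasure]
  simp [Set.indicator_apply]

theorem integral_massMeasure (w : ProbDist α) (f : α → ℝ) :
    ∫ a, f a ∂massMeasure w.1 = ∑ a, w.1 a * f a := by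
  have := isProbabilityMeasure_massMeasure w
  simp only [integral_fintype Integrable.of_finite, measureReal_def, massMeasure_singleton,
    ENNReal.toReal_ofReal (w.2.1 _), smul_eq_mul]

theorem massMeasure_gibbs (w : ProbDist α) (f : α → ℝ) :
    massMeasure (gibbs w f).1 = (massMeasure w.1).tilted f := by
  have := isProbabilityMeasure_massMeasure w
  refine Measure.ext_of_singleton fun a => ?_
  rw [massMeasure_singleton, tilted_apply, Measure.restrict_singleton, lintegral_smul_measure,
    lintegral_dirac, massMeasure_singleton, integral_massMeasure, smul_eq_mul,
    ← ENNReal.ofReal_mul (w.2.1 a), mul_div_assoc']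
  rfl

theorem toReal_klDiv_eq_add_klDiv_gibbs (π w : ProbDist α) (hac : massMeasure π.1 ≪ massMeasure w.1)
    (f : α → ℝ) :
    (InformationTheory.klDiv (massMeasure π.1) (massMeasure w.1)).toReal =
      ∑ a, π.1 a * f a - Real.log (partitionFn w.1 f) +
        (InformationTheory.klDiv (massMeasure π.1) (massMeasure (gibbs w f).1)).toReal := by
  have := isProbabilityMeasure_massMeasure w
  have := isProbabilityMeasure_massMeasure π
  have := isProbabilityMeasure_massMeasure (gibbs w f)
  have hexp : Integrable (fun a => Real.exp (f a)) (massMeasure w.1) := Integrable.of_finite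
  have hac' : massMeasure π.1 ≪ massMeasure (gibbs w f).1 := by
    rw [massMeasure_gibbs]
    exact hac.trans (absolutelyContinuous_tilted hexp)
  rw [InformationTheory.toReal_klDiv_of_measure_eq hac (by simp only [measure_univ]),
    InformationTheory.toReal_klDiv_of_measure_eq hac' (by simp only [measure_univ]),
    massMeasure_gibbs,
    integral_llr_tilted_right hac Integrable.of_finite hexp Integrable.of_finite,
    integral_massMeasure π f, integral_massMeasure w, partitionFn]
  ring

theorem klDiv_massMeasure_ne_top {π w : ProbDist α} (hac : massMeasure π.1 ≪ massMeasure w.1) :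
    InformationTheory.klDiv (massMeasure π.1) (massMeasure w.1) ≠ ⊤ :=
  have := isProbabilityMeasure_massMeasure π
  InformationTheory.klDiv_ne_top hac Integrable.of_finite

theorem sum_sub_log_partitionFn_le_klDiv (π w : ProbDist α) (f : α → ℝ) :
    ENNReal.ofReal (∑ a, π.1 a * f a - Real.log (partitionFn w.1 f)) ≤
      InformationTheory.klDiv (massMeasure π.1) (massMeasure w.1) := by
  by_cases hac : massMeasure π.1 ≪ massMeasure w.1
  · refine ENNReal.ofReal_le_of_le_toReal ?_
    rw [toReal_klDiv_eq_add_klDiv_gibbs π w hac f]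
    exact le_add_of_nonneg_right ENNReal.toReal_nonneg
  · rw [InformationTheory.klDiv_of_not_ac hac]
    exact le_top

theorem massMeasure_gibbs_absolutelyContinuous (w : ProbDist α) (f : α → ℝ) :
    massMeasure (gibbs w f).1 ≪ massMeasure w.1 := by
  rw [massMeasure_gibbs]
  exact tilted_absolutelyContinuous _ _

theorem toReal_klDiv_massMeasure_gibbs (w : ProbDist α) (f : α → ℝ) :
    (InformationTheory.klDiv (massMeasure (gibbs w f).1) (massMeasure w.1)).toReal =
      ∑ a, (gibbs w f).1 a * f a - Real.log (partitionFn w.1 f) := by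
  have := isProbabilityMeasure_massMeasure (gibbs w f)
  rw [toReal_klDiv_eq_add_klDiv_gibbs _ w (massMeasure_gibbs_absolutelyContinuous w f) f,
    InformationTheory.klDiv_self, ENNReal.toReal_zero, add_zero]

end Gibbs

/-! ### Autoregressive products -/

section PathProb

variable {X : Type*} [MeasurableSpace X] {K H : ℕ}

/-- A string of length less than `H`, as a prefix. -/
def toPrefix (l : List (Fin K)) (h : l.length < H) : Prefix K H := ⟨l, h⟩

/-- The string `y_{<t}` of a string `y` of length `n ≤ H`, as a prefix. -/
def initPrefix {n : ℕ} (hn : n ≤ H) (y : Fin n → Fin K) (t : Fin n) : Prefix K H :=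
  toPrefix ((List.ofFn y).take t) (by simp only [List.length_take, List.length_ofFn]; omega)

/-- The probability that a rollout at `x` starts with the string `y` of length `n ≤ H`. -/
def Generator.pathProb (M : Generator X K H) (x : X) {n : ℕ} (hn : n ≤ H) (y : Fin n → Fin K) :
    ℝ :=
  ∏ t : Fin n, (M.next x (initPrefix hn y t)).1 (y t)

theorem take_ofFn_snoc {n : ℕ} (y : Fin n → Fin K) (a : Fin K) {t : ℕ} (ht : t ≤ n) :
    (List.ofFn (Fin.snoc y a : Fin (n + 1) → Fin K)).take t = (List.ofFn y).take t := by
  rw [List.ofFn_succ_last, List.take_append_of_le_length (by simpa using ht)]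
  simp only [Fin.snoc_castSucc]

theorem Generator.pathProb_snoc (M : Generator X K H) (x : X) {n : ℕ} (hn : n < H)
    (y : Fin n → Fin K) (a : Fin K) :
    M.pathProb x (n := n + 1) hn (Fin.snoc y a) =
      M.pathProb x hn.le y * (M.next x (toPrefix (List.ofFn y) (by simpa using hn))).1 a := by
  rw [pathProb, Fin.prod_univ_castSucc, pathProb]
  simp only [initPrefix, toPrefix, Fin.snoc_castSucc, Fin.snoc_last, Fin.val_castSucc, Fin.val_last]
  congr 1
  · refine Finset.prod_congr rfl fun t _ => ?_
    simp only [take_ofFn_snoc y a t.2.le]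
  · simp only [take_ofFn_snoc y a le_rfl, List.take_of_length_le (List.length_ofFn (f := y)).le]

theorem Generator.sum_pathProb_init (M : Generator X K H) (x : X) {n : ℕ} (hn : n < H)
    (g : (Fin n → Fin K) → ℝ) :
    ∑ y : Fin (n + 1) → Fin K, M.pathProb x hn y * g (Fin.init y) =
      ∑ y : Fin n → Fin K, M.pathProb x hn.le y * g y := by
  rw [← (Fin.snocEquiv fun _ : Fin (n + 1) => Fin K).sum_comp, Fintype.sum_prod_type,
    Finset.sum_comm]
  refine Finset.sum_congr rfl fun y _ => ?_
  calc ∑ a, M.pathProb x (n := n + 1) hn (Fin.snoc y a) *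
        g (Fin.init (Fin.snoc y a : Fin (n + 1) → Fin K))
      = ∑ a, M.pathProb x hn.le y * g y *
          (M.next x (toPrefix (List.ofFn y) (by simpa using hn))).1 a :=
        Finset.sum_congr rfl fun a _ => by rw [M.pathProb_snoc, Fin.init_snoc]; ring
    _ = M.pathProb x hn.le y * g y := by rw [← Finset.mul_sum, (M.next x _).2.2, mul_one]

theorem Generator.sum_pathProb_castLE (M : Generator X K H) (x : X) {n m : ℕ} (hnm : n ≤ m)
    (hm : m ≤ H) (g : (Fin n → Fin K) → ℝ) :
    ∑ y : Fin m → Fin K, M.pathProb x hm y * g (fun i => y (Fin.castLE hnm i)) =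
      ∑ y : Fin n → Fin K, M.pathProb x (hnm.trans hm) y * g y := by
  induction m, hnm using Nat.le_induction with
  | base => rfl
  | succ m hnm ih =>
    rw [← ih (Nat.le_of_lt hm)]
    exact M.sum_pathProb_init x hm fun y => g fun i => y (Fin.castLE hnm i)

theorem Generator.sum_respProb (M : Generator X K H) (x : X) : ∑ y, M.respProb x y = 1 := by
  have h := M.sum_pathProb_castLE x (Nat.zero_le H) le_rfl fun _ => 1
  simp only [mul_one] at h
  exact h.trans (by simp [pathProb])

/-- The response distribution of a generator. -/
def Generator.respDist (M : Generator X K H) (x : X) : ProbDist (Resp K H) :=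
  ⟨M.respProb x, fun y => Finset.prod_nonneg fun t _ => (M.next x (visited y t)).2.1 _,
    M.sum_respProb x⟩

theorem Generator.measurable_respDist (M : Generator X K H) : Measurable M.respDist := by
  refine Measurable.subtype_mk (measurable_pi_lambda _ fun y => ?_)
  exact Finset.measurable_prod _ fun t _ =>
    (measurable_pi_apply (y t)).comp (measurable_subtype_coe.comp (M.measurable_next (visited y t)))

end PathProb

/-! ### Rewards supported on a single prompt -/

section Objective

variable {X : Type*} [MeasurableSpace X] {K H : ℕ} (I : Instance X K H) {ρ : Measure X} {β : ℝ}
  {xs : X}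

theorem ereal_coe_sub_le_of_ofReal_le {a c : ℝ} {b : ℝ≥0∞} (h : ENNReal.ofReal c ≤ b) :
    (a : EReal) - (b : EReal) ≤ ((a - c : ℝ) : EReal) := by
  rw [EReal.coe_sub]
  refine EReal.sub_le_sub le_rfl (le_trans ?_ (EReal.coe_ennreal_le_coe_ennreal_iff.2 h))
  rw [EReal.coe_ennreal_ofReal]
  exact EReal.coe_le_coe_iff.2 (le_max_left _ _)

theorem lintegral_eq_mul_of_forall_ne_eq_zero (hxs : MeasurableSet {xs}) {f : X → ℝ≥0∞}
    (hf : ∀ x, x ≠ xs → f x = 0) : ∫⁻ x, f x ∂ρ = f xs * ρ {xs} := by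
  rw [← setLIntegral_const, ← lintegral_indicator hxs]
  refine lintegral_congr fun x => ?_
  by_cases hx : x = xs
  · simp [hx]
  · simp [hx, hf x hx]

theorem mul_le_lintegral_of_measurableSet_singleton (hxs : MeasurableSet {xs}) (f : X → ℝ≥0∞) :
    f xs * ρ {xs} ≤ ∫⁻ x, f x ∂ρ := by
  classical
  rw [← setLIntegral_const, ← lintegral_indicator hxs]
  refine lintegral_mono fun x => Set.indicator_le' (fun x hx => ?_) (fun _ _ => zero_le) x
  rw [Set.mem_singleton_iff.1 hx]

theorem integral_sum_mul_reward (hxs : MeasurableSet {xs})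
    (hr : ∀ x, x ≠ xs → ∀ y, I.reward x y = 0) (π : Policy X K H) :
    ∫ x, ∑ y, (π.resp x).1 y * I.reward x y ∂ρ =
      ρ.real {xs} * ∑ y, (π.resp xs).1 y * I.reward xs y := by
  rw [← smul_eq_mul, ← setIntegral_const, ← integral_indicator hxs]
  refine integral_congr_ae (Filter.Eventually.of_forall fun x => ?_)
  by_cases hx : x = xs
  · simp [hx]
  · simp [hx, hr x hx]

theorem Instance.objective_le [IsFiniteMeasure ρ] (hβ : 0 ≤ β) (hxs : MeasurableSet {xs})
    (hr : ∀ x, x ≠ xs → ∀ y, I.reward x y = 0) (f : Resp K H → ℝ) (π : Policy X K H) :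
    I.objective ρ β π ≤ ((ρ.real {xs} * (∑ y, (π.resp xs).1 y * (I.reward xs y - β * f y) +
      β * Real.log (partitionFn (I.base.respProb xs) f)) : ℝ) : EReal) := by
  set c := ∑ y, (π.resp xs).1 y * f y - Real.log (partitionFn (I.base.respProb xs) f)
  have hkl : ENNReal.ofReal (β * (c * ρ.real {xs})) ≤
      ENNReal.ofReal β * ∫⁻ x, InformationTheory.klDiv (massMeasure (π.resp x).1)
        (massMeasure (I.base.respProb x)) ∂ρ := by
    rw [ENNReal.ofReal_mul hβ, ENNReal.ofReal_mul' measureReal_nonneg, ofReal_measureReal]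
    refine mul_le_mul_right (le_trans ?_ (mul_le_lintegral_of_measurableSet_singleton hxs _)) _
    exact mul_le_mul_left (sum_sub_log_partitionFn_le_klDiv (π.resp xs) (I.base.respDist xs) f) _
  rw [Instance.objective, integral_sum_mul_reward I hxs hr]
  refine (ereal_coe_sub_le_of_ofReal_le hkl).trans (EReal.coe_le_coe_iff.2 (le_of_eq ?_))
  simp only [c, mul_sub, Finset.sum_sub_distrib, mul_left_comm _ β, ← Finset.mul_sum]
  ring

open scoped Classical in
/-- The policy that follows the base generator, tilted by `e^{r/β}` at the prompt `xs`. -/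
def Instance.tiltedPolicy (β : ℝ) (hxs : MeasurableSet {xs}) : Policy X K H where
  resp x := if x = xs then gibbs (I.base.respDist xs) fun y => I.reward xs y / β
    else I.base.respDist x
  measurable_resp := Measurable.ite hxs measurable_const I.base.measurable_respDist

theorem lintegral_klDiv_tiltedPolicy (hxs : MeasurableSet {xs}) :
    ∫⁻ x, InformationTheory.klDiv (massMeasure ((I.tiltedPolicy β hxs).resp x).1)
        (massMeasure (I.base.respProb x)) ∂ρ =
      InformationTheory.klDiv (massMeasure ((I.tiltedPolicy β hxs).resp xs).1)
        (massMeasure (I.base.respProb xs)) * ρ {xs} := by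
  refine lintegral_eq_mul_of_forall_ne_eq_zero hxs fun x hx => ?_
  have := isProbabilityMeasure_massMeasure (I.base.respDist x)
  have hres : (I.tiltedPolicy β hxs).resp x = I.base.respDist x := if_neg hx
  rw [hres]
  exact InformationTheory.klDiv_self (massMeasure (I.base.respDist x).1)

theorem Instance.objective_tiltedPolicy [IsFiniteMeasure ρ] (hβ : 0 < β) (hxs : MeasurableSet {xs})
    (hr : ∀ x, x ≠ xs → ∀ y, I.reward x y = 0) :
    I.objective ρ β (I.tiltedPolicy β hxs) = ((ρ.real {xs} * (β * Real.log
      (partitionFn (I.base.respProb xs) fun y => I.reward xs y / β)) : ℝ) : EReal) := by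
  have hres : (I.tiltedPolicy β hxs).resp xs =
      gibbs (I.base.respDist xs) fun y => I.reward xs y / β := if_pos rfl
  have hkl := toReal_klDiv_massMeasure_gibbs (I.base.respDist xs) fun y => I.reward xs y / β
  have htop := klDiv_massMeasure_ne_top (massMeasure_gibbs_absolutelyContinuous
    (I.base.respDist xs) fun y => I.reward xs y / β)
  rw [Instance.objective, integral_sum_mul_reward I hxs hr, lintegral_klDiv_tiltedPolicy, hres]
  set π := gibbs (I.base.respDist xs) fun y => I.reward xs y / β
  change _ - ((ENNReal.ofReal β * (InformationTheory.klDiv (massMeasure π.1)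
    (massMeasure (I.base.respDist xs).1) * ρ {xs}) : ℝ≥0∞) : EReal) = _
  rw [← ENNReal.ofReal_toReal htop, ← ofReal_measureReal,
    ← ENNReal.ofReal_mul ENNReal.toReal_nonneg, ← ENNReal.ofReal_mul hβ.le,
    EReal.coe_ennreal_ofReal, max_eq_left (by positivity), ← EReal.coe_sub, hkl]
  refine congrArg _ ?_
  simp only [mul_div_assoc', ← Finset.sum_div, Generator.respDist]
  field_simp
  ring

theorem Instance.isOptimizer_tiltedPolicy [IsFiniteMeasure ρ] (hβ : 0 < β)
    (hxs : MeasurableSet {xs}) (hr : ∀ x, x ≠ xs → ∀ y, I.reward x y = 0) :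
    I.IsOptimizer ρ β (I.tiltedPolicy β hxs) := by
  intro π
  rw [I.objective_tiltedPolicy hβ hxs hr]
  refine (I.objective_le hβ.le hxs hr (fun y => I.reward xs y / β) π).trans_eq ?_
  simp only [mul_div_cancel₀ _ hβ.ne', sub_self, mul_zero, Finset.sum_const_zero, zero_add]

end Objective

/-! ### The hidden path -/

section HiddenPath

variable {K H : ℕ}

theorem pPlus_pos [NeZero K] (lam : ℝ) : 0 < pPlus K lam :=
  div_pos (Real.exp_pos _) (denom_pos (0 : Fin K) lam)

theorem pPlus_le_one [NeZero K] (lam : ℝ) : pPlus K lam ≤ 1 := by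
  have h1 : (1 : ℝ) ≤ K := by exact_mod_cast NeZero.one_le
  exact div_le_one_of_le₀ (by linarith) (denom_pos (0 : Fin K) lam).le

theorem pPlus_lt_one (hK : 2 ≤ K) (lam : ℝ) : pPlus K lam < 1 := by
  have h2 : (2 : ℝ) ≤ K := by exact_mod_cast hK
  rw [pPlus, div_lt_one (by linarith [Real.exp_pos lam])]
  linarith

theorem hiddenPathNext_of_eq_take [NeZero K] (lam : ℝ) {u : List (Fin K)} {p : Prefix K H} {t : ℕ}
    (hp : p.1 = u.take t) (ht : t < u.length) : hiddenPathNext lam u p = tilted lam u[t] := by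
  have hlen : p.1.length = t := by rw [hp, List.length_take]; omega
  rw [hiddenPathNext, dif_pos ⟨hp ▸ List.take_prefix _ _, by omega⟩]
  simp only [hlen]

theorem hiddenPathNext_congr [NeZero K] (lam : ℝ) {v u u' : List (Fin K)} {p : Prefix K H}
    (hu : v <+: u) (hu' : v <+: u') (hp : ¬ v <+: p.1) :
    hiddenPathNext lam u p = hiddenPathNext lam u' p := by
  by_cases hpv : p.1 <+: v
  · have hlt : p.1.length < v.length :=
      hpv.length_le.lt_of_ne fun h => hp (hpv.eq_of_length h ▸ List.prefix_rfl)
    have heq : ∀ w, v <+: w → p.1 = w.take p.1.length := fun w hw =>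
      List.prefix_iff_eq_take.1 (hpv.trans hw)
    rw [hiddenPathNext_of_eq_take lam (heq u hu) (hlt.trans_le hu.length_le),
      hiddenPathNext_of_eq_take lam (heq u' hu') (hlt.trans_le hu'.length_le),
      ← hu.getElem hlt, ← hu'.getElem hlt]
  · have hnot : ∀ w, v <+: w → ¬ p.1 <+: w := fun w hw h =>
      (List.prefix_or_prefix_of_prefix h hw).elim hpv hp
    rw [hiddenPathNext, dif_neg fun h => hnot u hu h.1, hiddenPathNext,
      dif_neg fun h => hnot u' hu' h.1]

variable {X : Type*} [MeasurableSpace X] {xs : X}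

theorem ofFn_prefix_ofFn_iff {n : ℕ} (hn : n ≤ H) {v : Fin n → Fin K} {y : Resp K H} :
    List.ofFn v <+: List.ofFn y ↔ (fun i => y (Fin.castLE hn i)) = v := by
  rw [List.prefix_iff_getElem, funext_iff]
  simp only [List.length_ofFn, List.getElem_ofFn]
  exact ⟨fun ⟨_, h⟩ i => (h i i.2).symm, fun h => ⟨hn, fun i hi => (h ⟨i, hi⟩).symm⟩⟩

theorem Generator.sum_respProb_extending (M : Generator X K H) (x : X) {n : ℕ} (hn : n ≤ H)
    (v : Fin n → Fin K) :
    ∑ y with List.ofFn v <+: List.ofFn y, M.respProb x y = M.pathProb x hn v := by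
  have h := M.sum_pathProb_castLE x hn le_rfl (Pi.single v 1)
  simp only [Pi.single_apply, mul_ite, mul_one, mul_zero, Finset.sum_ite_eq', Finset.mem_univ,
    if_true] at h
  rw [Finset.sum_filter, ← h]
  simp only [ofFn_prefix_ofFn_iff hn]
  rfl

theorem Generator.pathProb_eq_pPlus_pow [NeZero K] {lam : ℝ} {u : List (Fin K)}
    {M : Generator X K H} (hM : ∀ p, M.next xs p = hiddenPathNext lam u p) {n : ℕ} (hn : n ≤ H)
    {v : Fin n → Fin K} (hv : List.ofFn v <+: u) : M.pathProb xs hn v = pPlus K lam ^ n := by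
  rw [Generator.pathProb, ← Fin.prod_const]
  refine Finset.prod_congr rfl fun t _ => ?_
  have ht : t.1 < (List.ofFn v).length := by simp
  have htake : (initPrefix hn v t).1 = u.take t := by
    change (List.ofFn v).take t = u.take t
    rw [List.prefix_iff_eq_take.1 hv, List.take_take, min_eq_left ht.le]
  rw [hM, hiddenPathNext_of_eq_take lam htake (ht.trans_le hv.length_le), ← hv.getElem ht]
  simp [tilted]

end HiddenPath

/-! ### Regret on the hard family -/

section HardFamily

variable {X : Type*} [MeasurableSpace X] {K D L : ℕ} [NeZero K]

/-- The mass `q₀ = p_+^{D+L} / K` of the target under the base generator at the hard prompt. -/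
def targetMass (K D L : ℕ) (lam : ℝ) : ℝ := pPlus K lam ^ (D + L) / K

theorem targetMass_pos (K D L : ℕ) [NeZero K] (lam : ℝ) : 0 < targetMass K D L lam :=
  div_pos (pow_pos (pPlus_pos lam) _) (by exact_mod_cast Nat.pos_of_neZero K)

theorem targetMass_le_one (K D L : ℕ) [NeZero K] (lam : ℝ) : targetMass K D L lam ≤ 1 :=
  div_le_one_of_le₀ ((pow_le_one₀ (pPlus_pos lam).le (pPlus_le_one lam)).trans
    (by exact_mod_cast NeZero.one_le)) (Nat.cast_nonneg K)

variable (lam β : ℝ) {xs : X} (hxs : MeasurableSet {xs}) (easy : Generator X K (D + L + 1))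
  (v : Fin D → Fin K) (τ : Bool → Fin K) (s : Fin L → Fin K) (b : Bool)

theorem hardGenerator_next_hard (p : Prefix K (D + L + 1)) :
    (hardGenerator lam hxs easy v s).next xs p =
      hiddenPathNext lam (List.ofFn v ++ List.ofFn s) p :=
  if_pos rfl

theorem hardGenerator_next_of_ne {x : X} (hx : x ≠ xs) :
    (hardGenerator lam hxs easy v s).next x = easy.next x :=
  funext fun _ => if_neg hx

theorem hardGenerator_respProb_target :
    (hardGenerator lam hxs easy v s).respProb xs (target v τ s b) = targetMass K D L lam := by
  have happend : List.ofFn (Fin.append v s) = List.ofFn v ++ List.ofFn s := List.ofFn_fin_append v s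
  have hnext := hardGenerator_next_hard lam hxs easy v s
  refine ((hardGenerator lam hxs easy v s).pathProb_snoc xs (Nat.lt_succ_self _)
    (Fin.append v s) (τ b)).trans ?_
  rw [Generator.pathProb_eq_pPlus_pow hnext _ (happend ▸ List.prefix_rfl), hnext, hiddenPathNext,
    dif_neg fun h => h.2.ne (by simp [toPrefix]), targetMass, div_eq_mul_one_div]
  rfl

theorem hardInstance_reward_of_ne {x : X} (hx : x ≠ xs) (y : Resp K (D + L + 1)) :
    (hardInstance lam β hxs easy v τ s b).reward x y = 0 :=
  if_neg fun h => hx h.1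

theorem hardInstance_reward_hard (y : Resp K (D + L + 1)) :
    (hardInstance lam β hxs easy v τ s b).reward xs y =
      β * (Pi.single (target v τ s b) (Real.log (4 / targetMass K D L lam)) : _ → ℝ) y := by
  simp [hardInstance, Pi.single_apply, rewardScale, targetMass]

theorem partitionFn_single {α : Type*} [Fintype α] [DecidableEq α] (w : ProbDist α) (z : α)
    (c : ℝ) : partitionFn w.1 (Pi.single z c) = 1 + w.1 z * (Real.exp c - 1) := by
  have h : ∀ a, w.1 a * Real.exp ((Pi.single z c : α → ℝ) a) =
      w.1 a + if a = z then w.1 a * (Real.exp c - 1) else 0 := by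
    intro a
    rw [Pi.single_apply]
    split_ifs
    · ring
    · rw [Real.exp_zero, mul_one, add_zero]
  rw [partitionFn, Finset.sum_congr rfl fun a _ => h a, Finset.sum_add_distrib, w.2.2,
    Finset.sum_ite_eq', if_pos (Finset.mem_univ z)]

theorem partitionFn_hardGenerator {t : ℝ} (ht : 0 < t) :
    partitionFn ((hardGenerator lam hxs easy v s).respProb xs)
      (Pi.single (target v τ s b) (Real.log (t / targetMass K D L lam))) =
        1 - targetMass K D L lam + t := by
  have hq := targetMass_pos K D L lam
  refine (partitionFn_single ((hardGenerator lam hxs easy v s).respDist xs) _ _).trans ?_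
  simp only [Generator.respDist]
  rw [hardGenerator_respProb_target, Real.exp_log (div_pos ht hq)]
  field_simp
  ring

variable {ρ : Measure X} [IsFiniteMeasure ρ]

/-- The optimal policy for a target reward of `β log (1 / q₀)` serves as the comparison measure. -/
theorem hardInstance_objective_le (hβ : 0 ≤ β) (π : Policy X K (D + L + 1)) :
    (hardInstance lam β hxs easy v τ s b).objective ρ β π ≤
      ((ρ.real {xs} * (β * ((π.resp xs).1 (target v τ s b) * Real.log 4 +
        Real.log (2 - targetMass K D L lam))) : ℝ) : EReal) := by
  have hq := targetMass_pos K D L lam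
  refine ((hardInstance lam β hxs easy v τ s b).objective_le hβ hxs
    (fun x hx => hardInstance_reward_of_ne lam β hxs easy v τ s b hx)
    (Pi.single (target v τ s b) (Real.log (1 / targetMass K D L lam))) π).trans_eq ?_
  simp only [hardInstance_reward_hard, ← mul_sub, ← Pi.sub_apply, ← Pi.single_sub]
  rw [← Real.log_div (div_pos four_pos hq).ne' (one_div_pos.2 hq).ne',
    show (hardInstance lam β hxs easy v τ s b).base = hardGenerator lam hxs easy v s from rfl,
    partitionFn_hardGenerator lam hxs easy v τ s b one_pos]
  simp only [Pi.single_apply, mul_ite, mul_zero, Finset.sum_ite_eq', Finset.mem_univ, if_true,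
    div_div_div_cancel_right₀ hq.ne', div_one]
  refine congrArg _ ?_
  ring_nf

theorem le_iSup_hardInstance_objective (hβ : 0 < β) :
    ((ρ.real {xs} * (β * Real.log (5 - targetMass K D L lam)) : ℝ) : EReal) ≤
      ⨆ π, (hardInstance lam β hxs easy v τ s b).objective ρ β π := by
  refine le_trans (le_of_eq ?_)
    (le_iSup _ ((hardInstance lam β hxs easy v τ s b).tiltedPolicy β hxs))
  rw [Instance.objective_tiltedPolicy _ hβ hxs
    fun x hx => hardInstance_reward_of_ne lam β hxs easy v τ s b hx]
  simp only [hardInstance_reward_hard, mul_div_cancel_left₀ _ hβ.ne']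
  rw [show (hardInstance lam β hxs easy v τ s b).base = hardGenerator lam hxs easy v s from rfl,
    partitionFn_hardGenerator lam hxs easy v τ s b four_pos]
  ring_nf

theorem lt_resp_target_of_regret_le (hβ : 0 < β) (hη : 0 < ρ.real {xs})
    {π : Policy X K (D + L + 1)}
    (h : (hardInstance lam β hxs easy v τ s b).regret ρ β π ≤
      ((ρ.real {xs} * β / 4 : ℝ) : EReal)) :
    1 / 4 < (π.resp xs).1 (target v τ s b) := by
  set q := targetMass K D L lam
  set p := (π.resp xs).1 (target v τ s b)
  have hq : 0 < q := targetMass_pos K D L lam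
  have hq1 : q ≤ 1 := targetMass_le_one K D L lam
  have hgap : Real.log (5 - q) - (p * Real.log 4 + Real.log (2 - q)) ≤ 1 / 4 := by
    have hobj := (EReal.sub_le_sub (le_iSup_hardInstance_objective lam β hxs easy v τ s b hβ)
      (hardInstance_objective_le lam β hxs easy v τ s b hβ.le π)).trans h
    rw [← EReal.coe_sub, EReal.coe_le_coe_iff, ← mul_sub, ← mul_sub, mul_div_assoc] at hobj
    exact le_of_mul_le_mul_left ((le_of_mul_le_mul_left hobj hη).trans_eq (by ring)) hβ
  have hlog4 : Real.log 4 = 2 * Real.log 2 := by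
    rw [show (4 : ℝ) = 2 ^ 2 by norm_num, Real.log_pow, Nat.cast_ofNat]
  have hlog5 : Real.log 4 ≤ Real.log (5 - q) := Real.log_le_log four_pos (by linarith)
  have hlog2 : Real.log (2 - q) ≤ Real.log 2 := Real.log_le_log (by linarith) (by linarith)
  nlinarith [Real.log_two_gt_d9]

end HardFamily

/-! ### Oracles and total variation -/

section TotalVariation

variable {α B ι : Type*} [MeasurableSpace α] [MeasurableSpace B] {μ ν : Measure α} {ε ε' : ℝ≥0∞}

/-- `μ` exceeds `ν` by at most `ε` on measurable functions with values in `[0, 1]`; for probability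
measures this says that their total variation distance is at most `ε`. -/
def TVLe (μ ν : Measure α) (ε : ℝ≥0∞) : Prop :=
  ∀ g : α → ℝ≥0∞, Measurable g → (∀ a, g a ≤ 1) → ∫⁻ a, g a ∂μ ≤ ∫⁻ a, g a ∂ν + ε

theorem TVLe.refl (μ : Measure α) : TVLe μ μ 0 := fun _ _ _ => le_self_add

theorem TVLe.mono (h : TVLe μ ν ε) (hε : ε ≤ ε') : TVLe μ ν ε' := fun g hg hg1 =>
  (h g hg hg1).trans (add_le_add_right hε _)

theorem TVLe.map (h : TVLe μ ν ε) {φ : α → B} (hφ : Measurable φ) :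
    TVLe (μ.map φ) (ν.map φ) ε := by
  intro g hg hg1
  rw [lintegral_map hg hφ, lintegral_map hg hφ]
  exact h _ (hg.comp hφ) fun a => hg1 (φ a)

theorem TVLe.mixture [Fintype ι] {w w' : ι → ℝ} {κ κ' : ι → Measure B}
    [∀ i, IsProbabilityMeasure (κ i)] (S : Finset ι) (hw : ∀ i ∉ S, w i = w' i)
    (hκ : ∀ i ∉ S, κ i = κ' i) :
    TVLe (∑ i, ENNReal.ofReal (w i) • κ i) (∑ i, ENNReal.ofReal (w' i) • κ' i)
      (∑ i ∈ S, ENNReal.ofReal (w i)) := by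
  classical
  intro g _ hg1
  rw [lintegral_mixture, lintegral_mixture, ← Finset.univ_inter S, ← Finset.sum_ite_mem,
    ← Finset.sum_add_distrib]
  refine Finset.sum_le_sum fun i _ => ?_
  split_ifs with hi
  · have hle : ∫⁻ b, g b ∂κ i ≤ 1 := by simpa using lintegral_mono (μ := κ i) hg1
    exact le_add_left (mul_le_of_le_one_right' hle)
  · rw [hw i hi, hκ i hi, add_zero]

end TotalVariation

section Oracles

variable {X : Type*} [MeasurableSpace X] {K H : ℕ}

instance (M : Generator X K H) : IsMarkovKernel (prefixSample M) :=
  ⟨fun q => isProbabilityMeasure_massMeasure (M.next q.1 q.2)⟩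

instance {Q Y : Type*} [MeasurableSpace Q] [MeasurableSpace Y]
    (Γ : Kernel (X × Q × Resp K H × (Fin H → ProbDist (Fin K))) Y) [IsMarkovKernel Γ]
    (M : Generator X K H) : IsMarkovKernel (noReset Γ M) :=
  ⟨fun q => isProbabilityMeasure_mixture (M.respDist q.1) _⟩

instance (I : Instance X K H) : IsMarkovKernel (rewardOracle I) :=
  ⟨fun a => isProbabilityMeasure_mixture a.2 _⟩

theorem tvLe_noReset {Q Y : Type*} [MeasurableSpace Q] [MeasurableSpace Y]
    (Γ : Kernel (X × Q × Resp K H × (Fin H → ProbDist (Fin K))) Y) [IsMarkovKernel Γ]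
    {M M' : Generator X K H} {x : X} (S : Finset (Resp K H))
    (hM : ∀ y ∉ S, ∀ t, M.next x (visited y t) = M'.next x (visited y t)) (q : Q) :
    TVLe (noReset Γ M (x, q)) (noReset Γ M' (x, q))
      (∑ y ∈ S, ENNReal.ofReal (M.respProb x y)) := by
  refine TVLe.mixture S (fun y hy => ?_) fun y hy => ?_
  · simp only [Generator.respProb, hM y hy]
  · simp only [hM y hy]

theorem tvLe_rewardOracle {I I' : Instance X K H} {x : X} (S : Finset (Resp K H))
    (hI : ∀ y ∉ S, I.reward x y = I'.reward x y) (w : ProbDist (Resp K H)) :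
    TVLe (rewardOracle I (x, w)) (rewardOracle I' (x, w)) (∑ y ∈ S, ENNReal.ofReal (w.1 y)) :=
  TVLe.mixture S (fun _ _ => rfl) fun y hy => by simp only [hI y hy]

variable {GQ GR : Type*} [MeasurableSpace GQ] [MeasurableSpace GR]

theorem measurable_inr_inl_reply :
    Measurable fun o : Resp K H × ℝ => (Sum.inr (Sum.inl o) : Reply GR K H) :=
  measurable_inr.comp measurable_inl

instance (G : Kernel GQ GR) [IsMarkovKernel G]
    (R : Kernel (X × ProbDist (Resp K H)) (Resp K H × ℝ)) [IsMarkovKernel R] :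
    IsMarkovKernel (replyKernel G R) where
  isProbabilityMeasure
    | Sum.inl _ => Measure.isProbabilityMeasure_map measurable_inl.aemeasurable
    | Sum.inr (Sum.inl _) =>
      Measure.isProbabilityMeasure_map measurable_inr_inl_reply.aemeasurable
    | Sum.inr (Sum.inr _) => Measure.dirac.isProbabilityMeasure

theorem tvLe_replyKernel {G G' : Kernel GQ GR}
    {R R' : Kernel (X × ProbDist (Resp K H)) (Resp K H × ℝ)} {εG : GQ → ℝ≥0∞}
    {εR : X × ProbDist (Resp K H) → ℝ≥0∞} (hG : ∀ q, TVLe (G q) (G' q) (εG q))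
    (hR : ∀ a, TVLe (R a) (R' a) (εR a)) :
    ∀ a, TVLe (replyKernel G R a) (replyKernel G' R' a) (Sum.elim εG (Sum.elim εR 0) a)
  | Sum.inl q => (hG q).map measurable_inl
  | Sum.inr (Sum.inl a) => (hR a).map measurable_inr_inl_reply
  | Sum.inr (Sum.inr _) => TVLe.refl _

end Oracles

/-! ### Laws of runs -/

namespace Algorithm

/-- The seed and the first `n` replies of a run. -/
abbrev Transcript (Ω GR : Type*) (K H n : ℕ) : Type _ := Ω × (Fin n → Reply GR K H)

/-- A transcript with one more reply. -/
def extend {Ω GR : Type*} {K H n : ℕ} (τ : Transcript Ω GR K H n) (o : Reply GR K H) :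
    Transcript Ω GR K H (n + 1) :=
  (τ.1, Fin.snoc τ.2 o)

/-- The first `m` rounds of a transcript. -/
def truncate {Ω GR : Type*} {K H m n : ℕ} (hm : m ≤ n) (τ : Transcript Ω GR K H n) :
    Transcript Ω GR K H m :=
  (τ.1, fun i => τ.2 (Fin.castLE hm i))

theorem truncate_extend {Ω GR : Type*} {K H m n : ℕ} (hm : m ≤ n) (τ : Transcript Ω GR K H n)
    (o : Reply GR K H) :
    truncate (hm.trans n.le_succ) (extend τ o) = truncate hm τ :=
  Prod.ext rfl (funext fun i =>
    Fin.snoc_castSucc (α := fun _ => Reply GR K H) o τ.2 (Fin.castLE hm i))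

variable {Ω X GQ GR : Type*} [MeasurableSpace Ω] [MeasurableSpace X]
  [MeasurableSpace GQ] [MeasurableSpace GR] {K H : ℕ}

theorem measurable_truncate {m n : ℕ} (hm : m ≤ n) :
    Measurable (truncate hm : Transcript Ω GR K H n → Transcript Ω GR K H m) :=
  measurable_fst.prodMk
    (measurable_pi_lambda _ fun _ => (measurable_pi_apply _).comp measurable_snd)

theorem measurable_uncurry_extend (n : ℕ) :
    Measurable fun p : Transcript Ω GR K H n × Reply GR K H => extend p.1 p.2 := by
  refine (measurable_fst.comp measurable_fst).prodMk (measurable_pi_lambda _ fun i => ?_)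
  induction i using Fin.lastCases with
  | last => simpa only [Fin.snoc_last] using measurable_snd
  | cast i =>
    simp only [Fin.snoc_castSucc]
    exact (measurable_pi_apply i).comp (measurable_snd.comp measurable_fst)

theorem measurable_extend {n : ℕ} (τ : Transcript Ω GR K H n) : Measurable (extend τ) :=
  (measurable_uncurry_extend n).comp measurable_prodMk_left

variable (A : Algorithm Ω X GQ GR K H) (G G' : Kernel GQ GR)
  (R R' : Kernel (X × ProbDist (Resp K H)) (Resp K H × ℝ)) [IsMarkovKernel G] [IsMarkovKernel R]
  [IsMarkovKernel G'] [IsMarkovKernel R']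

theorem measurable_map_extend (n : ℕ) :
    Measurable fun τ : Transcript Ω GR K H n =>
      (replyKernel G R (A.act n τ)).map (extend τ) := by
  have h := ((Kernel.id ×ₖ (replyKernel G R).comap (A.act n) (A.measurable_act n)).map
    fun p : Transcript Ω GR K H n × Reply GR K H => extend p.1 p.2).measurable
  convert h using 2 with τ
  rw [Kernel.map_apply _ (measurable_uncurry_extend n), Kernel.prod_apply, Kernel.id_apply,
    Kernel.comap_apply, Measure.dirac_prod,
    Measure.map_map (measurable_uncurry_extend n) measurable_prodMk_left]
  rfl

theorem measurable_lintegral_extend {n : ℕ} {f : Transcript Ω GR K H (n + 1) → ℝ≥0∞}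
    (hf : Measurable f) :
    Measurable fun τ => ∫⁻ o, f (extend τ o) ∂replyKernel G R (A.act n τ) := by
  simp only [← lintegral_map hf (measurable_extend _)]
  exact (Measure.measurable_lintegral hf).comp (A.measurable_map_extend G R n)

theorem lintegral_lawUpTo_succ {n : ℕ} {f : Transcript Ω GR K H (n + 1) → ℝ≥0∞}
    (hf : Measurable f) : ∫⁻ τ, f τ ∂A.lawUpTo G R (n + 1) =
      ∫⁻ τ, ∫⁻ o, f (extend τ o) ∂replyKernel G R (A.act n τ) ∂A.lawUpTo G R n := by
  rw [lawUpTo]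
  refine (Measure.lintegral_bind (A.measurable_map_extend G R n).aemeasurable
    hf.aemeasurable).trans (lintegral_congr fun τ => lintegral_map hf (measurable_extend τ))

instance isProbabilityMeasure_lawUpTo (n : ℕ) : IsProbabilityMeasure (A.lawUpTo G R n) := by
  induction n with
  | zero =>
    have := A.isProbabilityMeasure_seedLaw
    exact Measure.isProbabilityMeasure_map
      (measurable_id.prodMk measurable_const).aemeasurable
  | succ n ih =>
    refine ⟨?_⟩
    rw [← lintegral_one, A.lintegral_lawUpTo_succ G R measurable_const]
    simp only [lintegral_const, measure_univ, mul_one]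

instance : IsProbabilityMeasure (A.law G R) := A.isProbabilityMeasure_lawUpTo G R A.rounds

theorem lintegral_lawUpTo_le_of_supermartingale (V : (n : ℕ) → Transcript Ω GR K H n → ℝ≥0∞)
    (hV : ∀ n, Measurable (V n)) {N : ℕ} (hstep : ∀ n < N, ∀ τ,
      ∫⁻ o, V (n + 1) (extend τ o) ∂replyKernel G R (A.act n τ) ≤ V n τ) :
    ∫⁻ τ, V N τ ∂A.lawUpTo G R N ≤ ∫⁻ τ, V 0 τ ∂A.lawUpTo G R 0 := by
  induction N with
  | zero => exact le_rfl
  | succ N ih =>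
    rw [A.lintegral_lawUpTo_succ G R (hV _)]
    exact (lintegral_mono fun τ => hstep N (Nat.lt_succ_self N) τ).trans
      (ih fun n hn => hstep n (hn.trans (Nat.lt_succ_self N)))

/-- The sum of a cost over the actions of the first `n` rounds. -/
def costUpTo (ε : Action X GQ K H → ℝ≥0∞) (n : ℕ) (τ : Transcript Ω GR K H n) : ℝ≥0∞ :=
  ∑ m : Fin n, ε (A.act m (truncate m.2.le τ))

theorem measurable_costUpTo {ε : Action X GQ K H → ℝ≥0∞} (hε : Measurable ε) (n : ℕ) :
    Measurable (A.costUpTo ε n) :=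
  Finset.measurable_sum _ fun m _ =>
    hε.comp ((A.measurable_act m).comp (measurable_truncate m.2.le))

theorem costUpTo_extend (ε : Action X GQ K H → ℝ≥0∞) {n : ℕ} (τ : Transcript Ω GR K H n)
    (o : Reply GR K H) :
    A.costUpTo ε (n + 1) (extend τ o) = ε (A.act n τ) + A.costUpTo ε n τ := by
  rw [costUpTo, Fin.sum_univ_castSucc, add_comm]
  exact congrArg₂ _ (congrArg (fun τ => ε (A.act n τ)) (truncate_extend le_rfl τ o))
    (Finset.sum_congr rfl fun m _ =>
      congrArg (fun τ => ε (A.act m τ)) (truncate_extend m.2.le τ o))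

theorem lintegral_lawUpTo_le_of_tvLe {ε : Action X GQ K H → ℝ≥0∞} (hε : Measurable ε)
    (htv : ∀ a, TVLe (replyKernel G R a) (replyKernel G' R' a) (ε a)) {n : ℕ}
    {f : Transcript Ω GR K H n → ℝ≥0∞} (hf : Measurable f) (hf1 : ∀ τ, f τ ≤ 1) :
    ∫⁻ τ, f τ ∂A.lawUpTo G R n ≤ ∫⁻ τ, f τ + A.costUpTo ε n τ ∂A.lawUpTo G' R' n := by
  induction n with
  | zero => exact lintegral_mono fun τ => le_self_add
  | succ n ih =>
    have hmeas : Measurable fun τ => f τ + A.costUpTo ε (n + 1) τ :=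
      hf.add (A.measurable_costUpTo hε _)
    rw [A.lintegral_lawUpTo_succ G R hf, A.lintegral_lawUpTo_succ G' R' hmeas]
    have hle1 : ∀ τ : Transcript Ω GR K H n,
        ∫⁻ o, f (extend τ o) ∂replyKernel G R (A.act n τ) ≤ 1 := fun τ => by
      simpa using lintegral_mono (μ := replyKernel G R (A.act n τ)) fun o => hf1 (extend τ o)
    refine (ih (A.measurable_lintegral_extend G R hf) hle1).trans (lintegral_mono fun τ => ?_)
    have hfτ : Measurable fun o => f (extend τ o) := hf.comp (measurable_extend τ)
    simp only [A.costUpTo_extend]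
    rw [lintegral_add_left hfτ, lintegral_const, measure_univ, mul_one, ← add_assoc]
    exact add_le_add_left (htv _ _ hfτ fun o => hf1 _) _

end Algorithm

/-! ### The lower bound for no-reset access -/

namespace Algorithm

/-- The cost function with price `cg` for a generator query and `cr` for a reward query. -/
def queryCost {X GQ : Type*} {K H : ℕ} (cg cr : ℝ≥0∞) : Action X GQ K H → ℝ≥0∞ :=
  Sum.elim (fun _ => cg) (Sum.elim (fun _ => cr) 0)

variable {Ω X GQ GR : Type*} [MeasurableSpace Ω] [MeasurableSpace X]
  [MeasurableSpace GQ] [MeasurableSpace GR] {K H : ℕ} {A : Algorithm Ω X GQ GR K H} {g r : ℕ}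

theorem UsesAtMost.costUpTo_queryCost_le (hA : A.UsesAtMost g r) (cg cr : ℝ≥0∞)
    (τ : Transcript Ω GR K H A.rounds) :
    A.costUpTo (queryCost cg cr) A.rounds τ ≤ g * cg + r * cr := by
  classical
  have hcost : ∀ m, queryCost cg cr (A.actionAt τ m) =
      (if ∃ q, A.actionAt τ m = Sum.inl q then cg else 0) +
      (if ∃ a, A.actionAt τ m = Sum.inr (Sum.inl a) then cr else 0) := fun m => by
    rcases A.actionAt τ m with q | a | u <;> simp [queryCost]
  obtain ⟨hg, hr⟩ := hA τ
  rw [genCount, Nat.card_eq_fintype_card, Fintype.card_subtype] at hg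
  rw [rewardCount, Nat.card_eq_fintype_card, Fintype.card_subtype] at hr
  refine (Finset.sum_congr rfl fun m _ => hcost m).trans_le ?_
  simp only [Finset.sum_add_distrib, ← Finset.sum_filter, Finset.sum_const, nsmul_eq_mul]
  gcongr

theorem UsesAtMost.sum_costUpTo_le {ι : Type*} [Fintype ι] {ε : ι → Action X GQ K H → ℝ≥0∞}
    {cg cr : ℝ≥0∞} (hA : A.UsesAtMost g r) (hε : ∀ a, ∑ i, ε i a ≤ queryCost cg cr a)
    (τ : Transcript Ω GR K H A.rounds) :
    ∑ i, A.costUpTo (ε i) A.rounds τ ≤ g * cg + r * cr := by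
  refine le_trans ?_ (hA.costUpTo_queryCost_le cg cr τ)
  simp only [costUpTo]
  rw [Finset.sum_comm]
  exact Finset.sum_le_sum fun m _ => hε _

/-- Each instance `i` is compared with one common reference instance, under which the events `E i`
cannot all be likely. -/
theorem UsesAtMost.sum_law_le_of_tvLe {ι : Type*} [Fintype ι] (hA : A.UsesAtMost g r)
    {G : ι → Kernel GQ GR} {R : ι → Kernel (X × ProbDist (Resp K H)) (Resp K H × ℝ)}
    [∀ i, IsMarkovKernel (G i)] [∀ i, IsMarkovKernel (R i)] (G' : Kernel GQ GR)
    (R' : Kernel (X × ProbDist (Resp K H)) (Resp K H × ℝ)) [IsMarkovKernel G'] [IsMarkovKernel R']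
    {ε : ι → Action X GQ K H → ℝ≥0∞} (hε : ∀ i, Measurable (ε i))
    (htv : ∀ i a, TVLe (replyKernel (G i) (R i) a) (replyKernel G' R' a) (ε i a))
    {cg cr : ℝ≥0∞} (hcost : ∀ a, ∑ i, ε i a ≤ queryCost cg cr a)
    {E : ι → Set (Transcript Ω GR K H A.rounds)} (hE : ∀ i, MeasurableSet (E i)) {c : ℝ≥0∞}
    (hc : ∀ τ, ∑ i, (E i).indicator 1 τ ≤ c) :
    ∑ i, A.law (G i) (R i) (E i) ≤ c + (g * cg + r * cr) := by
  have hmeas : ∀ i, Measurable ((E i).indicator (1 : Transcript Ω GR K H A.rounds → ℝ≥0∞)) :=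
    fun i => measurable_one.indicator (hE i)
  calc ∑ i, A.law (G i) (R i) (E i)
      = ∑ i, ∫⁻ τ, (E i).indicator 1 τ ∂A.law (G i) (R i) :=
        Finset.sum_congr rfl fun i _ => (lintegral_indicator_one (hE i)).symm
    _ ≤ ∑ i, ∫⁻ τ, (E i).indicator 1 τ + A.costUpTo (ε i) A.rounds τ ∂A.law G' R' :=
        Finset.sum_le_sum fun i _ => A.lintegral_lawUpTo_le_of_tvLe (G i) G' (R i) R' (hε i)
          (htv i) (hmeas i) (Set.indicator_le_self' fun _ _ => zero_le)
    _ = ∫⁻ τ, ∑ i, (E i).indicator 1 τ + ∑ i, A.costUpTo (ε i) A.rounds τ ∂A.law G' R' := by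
        simp only [← Finset.sum_add_distrib]
        exact (lintegral_finsetSum _ fun i _ =>
          (hmeas i).add (A.measurable_costUpTo (hε i) _)).symm
    _ ≤ ∫⁻ _, c + (g * cg + r * cr) ∂A.law G' R' :=
        lintegral_mono fun τ => add_le_add (hc τ) (hA.sum_costUpTo_le hcost τ)
    _ = c + (g * cg + r * cr) := by rw [lintegral_const, measure_univ, mul_one]

end Algorithm

section Leak

variable {X Q : Type*} {K D L : ℕ} (lam : ℝ) (v : Fin D → Fin K) (τ : Bool → Fin K) (b : Bool)

theorem target_injective : Function.Injective fun s : Fin L → Fin K => target v τ s b := by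
  intro s s' h
  funext i
  simpa only [target, Fin.snoc_castSucc, Fin.append_right] using
    congrFun h (Fin.castSucc (Fin.natAdd D i))

theorem sum_ofReal_target_le_one (w : ProbDist (Resp K (D + L + 1))) :
    ∑ s : Fin L → Fin K, ENNReal.ofReal (w.1 (target v τ s b)) ≤ 1 := by
  classical
  rw [← Finset.sum_image (f := fun y => ENNReal.ofReal (w.1 y)) fun s _ s' _ h =>
    target_injective v τ b h, ← sum_ofReal_probDist w]
  exact Finset.sum_le_univ_sum_of_nonneg fun _ => zero_le

theorem sum_indicator_lt_target_le (w : ProbDist (Resp K (D + L + 1))) :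
    ∑ s : Fin L → Fin K, Set.indicator
      {w : ProbDist (Resp K (D + L + 1)) | 1 / 4 < w.1 (target v τ s b)}
      (1 : ProbDist (Resp K (D + L + 1)) → ℝ≥0∞) w ≤ 4 := by
  refine (Finset.sum_le_sum (g := fun s => 4 * ENNReal.ofReal (w.1 (target v τ s b)))
    fun s _ => ?_).trans ?_
  · refine Set.indicator_apply_le' (fun hw => ?_) fun _ => zero_le
    rw [show (4 : ℝ≥0∞) = ENNReal.ofReal 4 by norm_num, ← ENNReal.ofReal_mul four_pos.le]
    exact ENNReal.one_le_ofReal.2 (by linarith [show 1 / 4 < w.1 (target v τ s b) from hw])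
  · rw [← Finset.mul_sum]
    exact mul_le_of_le_one_right' (sum_ofReal_target_le_one v τ b w)

open scoped Classical in
/-- The total variation by which the reply to an action on the instance `(s, b)` can differ from the
reply on a reference instance: a rollout must follow the whole public prefix `v`, a reward query
must hit the target. -/
def leak (xs : X) (s : Fin L → Fin K) : Action X (X × Q) K (D + L + 1) → ℝ≥0∞ :=
  Sum.elim (fun _ => ENNReal.ofReal (pPlus K lam ^ D))
    (Sum.elim (fun a => if a.1 = xs then ENNReal.ofReal (a.2.1 (target v τ s b)) else 0) 0)

theorem sum_leak_le (xs : X) (a : Action X (X × Q) K (D + L + 1)) :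
    ∑ s : Fin L → Fin K, leak lam v τ b xs s a ≤
      Algorithm.queryCost ((K : ℝ≥0∞) ^ L * ENNReal.ofReal (pPlus K lam ^ D)) 1 a := by
  rcases a with q | ⟨x, w⟩ | u
  · simp [leak, Algorithm.queryCost]
  · by_cases hx : x = xs
    · simpa [leak, Algorithm.queryCost, hx] using sum_ofReal_target_le_one v τ b w
    · simp [leak, Algorithm.queryCost, hx]
  · simp [leak, Algorithm.queryCost]

theorem measurable_probDist_apply {α : Type*} [Fintype α] (a : α) :
    Measurable fun w : ProbDist α => w.1 a :=
  (measurable_pi_apply a).comp measurable_subtype_coe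

theorem measurable_leak [MeasurableSpace X] [MeasurableSpace Q] {xs : X} (s : Fin L → Fin K)
    (hxs : MeasurableSet {xs}) :
    Measurable (leak (Q := Q) lam v τ b xs s) :=
  measurable_const.sumElim ((Measurable.ite (measurable_fst hxs)
    ((measurable_probDist_apply _).comp measurable_snd).ennreal_ofReal measurable_const).sumElim
      measurable_const)

end Leak

section NoReset

variable {X Q Y : Type*} [MeasurableSpace X] [MeasurableSpace Q] [MeasurableSpace Y] {K D L : ℕ}
  [NeZero K] (lam β : ℝ) {xs : X} (hxs : MeasurableSet {xs}) (easy : Generator X K (D + L + 1))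
  (v : Fin D → Fin K) (τ : Bool → Fin K) (s s' : Fin L → Fin K) (b : Bool)

/-- The instance with base generator `M` and zero reward, used as the reference instance of the
lower bound. -/
def zeroRewardInstance {H : ℕ} (M : Generator X K H) : Instance X K H where
  base := M
  reward _ _ := 0
  measurable_reward _ := measurable_const
  bounded_reward := ⟨0, by simp⟩

theorem tvLe_noReset_hardGenerator
    (Γ : Kernel (X × Q × Resp K (D + L + 1) × (Fin (D + L + 1) → ProbDist (Fin K))) Y)
    [IsMarkovKernel Γ] (q : X × Q) :
    TVLe (noReset Γ (hardGenerator lam hxs easy v s) q)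
      (noReset Γ (hardGenerator lam hxs easy v s') q) (ENNReal.ofReal (pPlus K lam ^ D)) := by
  classical
  obtain ⟨x, q⟩ := q
  by_cases hx : x = xs
  · subst hx
    have hpre : ∀ s : Fin L → Fin K, List.ofFn v <+: List.ofFn v ++ List.ofFn s := fun s =>
      List.prefix_append _ _
    have hmass := ((hardGenerator lam hxs easy v s).sum_respProb_extending x
      ((Nat.le_add_right D L).trans (Nat.le_succ _)) v).trans
        (Generator.pathProb_eq_pPlus_pow (hardGenerator_next_hard lam hxs easy v s) _ (hpre s))
    have hnonneg : ∀ y, 0 ≤ (hardGenerator lam hxs easy v s).respProb x y :=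
      ((hardGenerator lam hxs easy v s).respDist x).2.1
    rw [← hmass, ENNReal.ofReal_sum_of_nonneg fun y _ => hnonneg y]
    refine tvLe_noReset Γ _ (fun y hy t => ?_) q
    rw [hardGenerator_next_hard, hardGenerator_next_hard]
    refine hiddenPathNext_congr lam (hpre s) (hpre s') fun h => hy ?_
    exact Finset.mem_filter.2 ⟨Finset.mem_univ _, h.trans (List.take_prefix _ _)⟩
  · refine (tvLe_noReset Γ ∅ (fun y _ t => ?_) q).mono (zero_le)
    rw [hardGenerator_next_of_ne lam hxs easy v s hx, hardGenerator_next_of_ne lam hxs easy v s' hx]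

open scoped Classical in
theorem tvLe_rewardOracle_hardInstance (M : Generator X K (D + L + 1))
    (a : X × ProbDist (Resp K (D + L + 1))) :
    TVLe (rewardOracle (hardInstance lam β hxs easy v τ s b) a)
      (rewardOracle (zeroRewardInstance M) a)
      (if a.1 = xs then ENNReal.ofReal (a.2.1 (target v τ s b)) else 0) := by
  obtain ⟨x, w⟩ := a
  refine (tvLe_rewardOracle (if x = xs then {target v τ s b} else ∅) (fun y hy => ?_) w).mono
    (le_of_eq ?_)
  · refine if_neg fun h => hy ?_
    rw [if_pos h.1, h.2]
    exact Finset.mem_singleton_self _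
  · by_cases hx : x = xs <;> simp [hx]

/-- On average over the `K ^ L` suffixes, the success events are rare under the reference instance,
and the replies leak little about the suffix. -/
theorem two_thirds_mul_pow_le_of_noReset {Ω : Type*} [MeasurableSpace Ω] {ρ : Measure X}
    [IsFiniteMeasure ρ] (hβ : 0 < β) (hη : 0 < ρ.real {xs})
    (Γ : Kernel (X × Q × Resp K (D + L + 1) × (Fin (D + L + 1) → ProbDist (Fin K))) Y)
    [IsMarkovKernel Γ] {A : Algorithm Ω X (X × Q) Y K (D + L + 1)} {qg qr : ℕ}
    (hA : A.UsesAtMost qg qr)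
    (hs : ∀ s : Fin L → Fin K, 2 / 3 ≤ (A.law (noReset Γ (hardGenerator lam hxs easy v s))
        (rewardOracle (hardInstance lam β hxs easy v τ s b))).real
        {run | (hardInstance lam β hxs easy v τ s b).regret ρ β (A.policy run) ≤
          ((ρ.real {xs} * β / 4 : ℝ) : EReal)}) :
    2 / 3 * (K : ℝ) ^ L ≤ 4 + (qg * ((K : ℝ) ^ L * pPlus K lam ^ D) + qr) := by
  set P := fun s => A.law (noReset Γ (hardGenerator lam hxs easy v s))
    (rewardOracle (hardInstance lam β hxs easy v τ s b))
  set M' := hardGenerator lam hxs easy v fun _ => 0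
  set E := fun s : Fin L → Fin K => {run | 1 / 4 < ((A.policy run).resp xs).1 (target v τ s b)}
  have hE : ∀ s, MeasurableSet (E s) := fun s => measurableSet_lt measurable_const
    ((measurable_probDist_apply _).comp (A.measurable_output.comp measurable_prodMk_right))
  have htv : ∀ s a, TVLe (replyKernel (noReset Γ (hardGenerator lam hxs easy v s))
      (rewardOracle (hardInstance lam β hxs easy v τ s b)) a)
      (replyKernel (noReset Γ M') (rewardOracle (zeroRewardInstance M')) a)
      (leak lam v τ b xs s a) := fun s =>
    tvLe_replyKernel (tvLe_noReset_hardGenerator lam hxs easy v s _ Γ)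
      (tvLe_rewardOracle_hardInstance lam β hxs easy v τ s b M')
  have hsum : ∑ s, P s (E s) ≤
      4 + (qg * ((K : ℝ≥0∞) ^ L * ENNReal.ofReal (pPlus K lam ^ D)) + qr * 1) :=
    hA.sum_law_le_of_tvLe _ _ (fun s => measurable_leak lam v τ b s hxs) htv
      (sum_leak_le lam v τ b xs) hE fun run => sum_indicator_lt_target_le v τ b _
  have hsucc : ∀ s, 2 / 3 ≤ (P s).real (E s) := fun s => (hs s).trans <|
    measureReal_mono fun run hrun => lt_resp_target_of_regret_le lam β hxs easy v τ s b hβ hη hrun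
  have hreal : ∑ s, (P s).real (E s) ≤ 4 + (qg * ((K : ℝ) ^ L * pPlus K lam ^ D) + qr) := by
    have h := ENNReal.toReal_mono (by finiteness) hsum
    rw [ENNReal.toReal_sum fun s _ => measure_ne_top _ _, ENNReal.toReal_add (by finiteness)
      (by finiteness), ENNReal.toReal_add (by finiteness) (by finiteness)] at h
    simpa [ENNReal.toReal_ofReal (pow_pos (pPlus_pos lam) D).le, Measure.real] using h
  refine le_trans (le_of_eq ?_) ((Finset.sum_le_sum fun s _ => hsucc s).trans hreal)
  simp [mul_comm]

end NoReset

/-! ### Plurality votes -/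

section VoteWeight

variable {K : ℕ}

/-- The square root of the likelihood ratio of the token `b` under `tilted lam a` and under
`tilted lam c`; its product over a block is at least `1` when `a` wins the vote against `c`. -/
def voteWeight (lam : ℝ) (c a b : Fin K) : ℝ :=
  Real.exp (lam / 2 * ((if b = a then 1 else 0) - if b = c then 1 else 0))

theorem voteWeight_pos (lam : ℝ) (c a b : Fin K) : 0 < voteWeight lam c a b := Real.exp_pos _

/-- The Bhattacharyya coefficient of `tilted lam a` and `tilted lam c` for `a ≠ c`. -/
def voteRate (K : ℕ) (lam : ℝ) : ℝ :=
  (2 * Real.exp (lam / 2) + K - 2) / (Real.exp lam + K - 1)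

theorem voteRate_pos (hK : 2 ≤ K) (lam : ℝ) : 0 < voteRate K lam := by
  have hK' : (2 : ℝ) ≤ K := by exact_mod_cast hK
  have := Real.exp_pos lam
  have := Real.exp_pos (lam / 2)
  exact div_pos (by linarith) (by linarith)

theorem voteRate_lt_one (hK : 2 ≤ K) {lam : ℝ} (hlam : 0 < lam) : voteRate K lam < 1 := by
  have hK' : (2 : ℝ) ≤ K := by exact_mod_cast hK
  have hhalf : 1 < Real.exp (lam / 2) := Real.one_lt_exp_iff.2 (by linarith)
  have hsq : Real.exp lam = Real.exp (lam / 2) ^ 2 := by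
    rw [← Real.exp_nat_mul, Nat.cast_ofNat, mul_div_cancel₀ _ two_ne_zero]
  have := Real.exp_pos lam
  rw [voteRate, div_lt_one (by linarith), hsq]
  nlinarith

theorem sum_tilted_mul_voteWeight (lam : ℝ) {c a : Fin K} (h : a ≠ c) :
    ∑ b, (tilted lam c).1 b * voteWeight lam c a b = voteRate K lam := by
  have hd := denom_pos c lam
  have hsummand : ∀ b, (tilted lam c).1 b * voteWeight lam c a b = pMinus K lam +
      ((if b = c then pPlus K lam * Real.exp (-(lam / 2)) - pMinus K lam else 0) +
      if b = a then pMinus K lam * Real.exp (lam / 2) - pMinus K lam else 0) := by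
    intro b
    rcases eq_or_ne b c with rfl | hbc
    · simp [tilted, voteWeight, h.symm]
    · rcases eq_or_ne b a with rfl | hba
      · simp [tilted, voteWeight, hbc]
      · simp [tilted, voteWeight, hbc, hba]
  have hexp : Real.exp lam * Real.exp (-(lam / 2)) = Real.exp (lam / 2) := by
    rw [← Real.exp_add, ← sub_eq_add_neg, sub_half]
  simp only [hsummand, Finset.sum_add_distrib, Finset.sum_const, Finset.card_univ,
    Fintype.card_fin, nsmul_eq_mul, Finset.sum_ite_eq', Finset.mem_univ, if_true]
  rw [pPlus, pMinus, voteRate, div_mul_eq_mul_div, hexp]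
  field_simp
  ring

theorem sum_ofReal_tilted_mul_voteWeight (lam : ℝ) {c a : Fin K} (h : a ≠ c) :
    ∑ b, ENNReal.ofReal ((tilted lam c).1 b) * ENNReal.ofReal (voteWeight lam c a b) =
      ENNReal.ofReal (voteRate K lam) := by
  simp only [← ENNReal.ofReal_mul ((tilted lam c).2.1 _)]
  rw [← sum_tilted_mul_voteWeight lam h, ENNReal.ofReal_sum_of_nonneg fun b _ =>
    mul_nonneg ((tilted lam c).2.1 b) (voteWeight_pos lam c a b).le]

/-- The factor of `votePotential` at position `i` once the tokens before `n` are known: the actual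
weight of a known token, the expected weight of a future one. -/
def voteFactor (lam : ℝ) (c a : Fin K) (n : ℕ) (x : ℕ → Fin K) (i : ℕ) : ℝ≥0∞ :=
  if i < n then ENNReal.ofReal (voteWeight lam c a (x i)) else ENNReal.ofReal (voteRate K lam)

theorem voteFactor_of_lt (lam : ℝ) (c a : Fin K) (x : ℕ → Fin K) {i n : ℕ} (hi : i < n) :
    voteFactor lam c a n x i = ENNReal.ofReal (voteWeight lam c a (x i)) := if_pos hi

theorem voteFactor_succ_of_ne (lam : ℝ) (c a : Fin K) {x x' : ℕ → Fin K} {n : ℕ}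
    (h : ∀ i < n, x' i = x i) {i : ℕ} (hi : i ≠ n) :
    voteFactor lam c a (n + 1) x' i = voteFactor lam c a n x i := by
  rcases hi.lt_or_gt with hlt | hgt
  · rw [voteFactor_of_lt _ _ _ _ hlt, voteFactor_of_lt _ _ _ _ (hlt.trans n.lt_succ_self), h i hlt]
  · rw [voteFactor, voteFactor, if_neg hgt.not_gt, if_neg (Nat.succ_le_of_lt hgt).not_gt]

end VoteWeight

section Votes

variable {K : ℕ} {x x' : ℕ → Fin K} {N d n : ℕ}

/-- The number of occurrences of `a` in the `d`-th block of length `N` of `x`. -/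
def blockCount (x : ℕ → Fin K) (N d : ℕ) (a : Fin K) : ℕ :=
  ((Finset.Ico (d * N) ((d + 1) * N)).filter fun i => x i = a).card

theorem blockCount_congr (h : ∀ i < (d + 1) * N, x i = x' i) :
    blockCount x N d = blockCount x' N d :=
  funext fun a => congrArg Finset.card <| Finset.filter_congr fun i hi => by
    rw [h i (Finset.mem_Ico.1 hi).2]

variable [NeZero K]

/-- A most frequent token of the `d`-th block of length `N` of `x`. -/
def plurality (x : ℕ → Fin K) (N d : ℕ) : Fin K := (Finite.exists_max (blockCount x N d)).choose

theorem blockCount_le_blockCount_plurality (x : ℕ → Fin K) (N d : ℕ) (a : Fin K) :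
    blockCount x N d a ≤ blockCount x N d (plurality x N d) :=
  (Finite.exists_max (blockCount x N d)).choose_spec a

theorem plurality_congr (h : ∀ i < (d + 1) * N, x i = x' i) :
    plurality x N d = plurality x' N d := by
  simp only [plurality, blockCount_congr h]

theorem one_le_prod_voteWeight_plurality {lam : ℝ} (hlam : 0 ≤ lam) (x : ℕ → Fin K) (N d : ℕ)
    (c : Fin K) :
    1 ≤ ∏ i ∈ Finset.Ico (d * N) ((d + 1) * N), voteWeight lam c (plurality x N d) (x i) := by
  simp only [voteWeight]
  rw [← Real.exp_sum, Real.one_le_exp_iff, ← Finset.mul_sum, Finset.sum_sub_distrib,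
    Finset.sum_boole, Finset.sum_boole]
  exact mul_nonneg (by linarith)
    (sub_nonneg.2 (Nat.cast_le.2 (blockCount_le_blockCount_plurality x N d c)))

/-- The word of the first `d` plurality votes. -/
def estPrefix (x : ℕ → Fin K) (N d : ℕ) : List (Fin K) := (List.range d).map (plurality x N)

theorem length_estPrefix (x : ℕ → Fin K) (N d : ℕ) : (estPrefix x N d).length = d := by
  simp only [estPrefix, List.length_map, List.length_range]

theorem estPrefix_succ (x : ℕ → Fin K) (N d : ℕ) :
    estPrefix x N (d + 1) = estPrefix x N d ++ [plurality x N d] := by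
  simp only [estPrefix, List.range_succ, List.map_append, List.map_singleton]

theorem estPrefix_congr (h : ∀ i < d * N, x i = x' i) : estPrefix x N d = estPrefix x' N d :=
  List.map_congr_left fun _ he => plurality_congr fun i hi =>
    h i (hi.trans_le (Nat.mul_le_mul_right _ (Nat.succ_le_of_lt (List.mem_range.1 he))))

theorem exists_first_error {u : List (Fin K)} (hn : n ≤ u.length)
    (h : estPrefix x N n ≠ u.take n) :
    ∃ d, ∃ hd : d < u.length, estPrefix x N d = u.take d ∧ plurality x N d ≠ u[d] := by
  induction n with
  | zero => exact absurd rfl h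
  | succ n ih =>
    by_cases hprev : estPrefix x N n = u.take n
    · refine ⟨n, hn, hprev, fun he => h ?_⟩
      rw [estPrefix_succ, hprev, he, List.take_append_getElem]
    · exact ih (Nat.le_of_succ_le hn) hprev

/-- The Chernoff potential of the event that the votes find the word `p` of length `d` and then
elect `a` instead of the favored token `c`, once the tokens before `n` are known. -/
def votePotential (lam : ℝ) (p : List (Fin K)) (c a : Fin K) (N d n : ℕ) (x : ℕ → Fin K) : ℝ≥0∞ :=
  if n < d * N ∨ estPrefix x N d = p then
    ∏ i ∈ Finset.Ico (d * N) ((d + 1) * N), voteFactor lam c a n x i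
  else 0

variable (lam : ℝ) (p : List (Fin K)) (c a : Fin K)

theorem votePotential_zero_le (x : ℕ → Fin K) :
    votePotential lam p c a N d 0 x ≤ ENNReal.ofReal (voteRate K lam) ^ N := by
  refine (ite_le_sup _ _ _).trans (sup_le (le_of_eq ?_) zero_le)
  simp only [voteFactor, Nat.not_lt_zero, if_false, Finset.prod_const, Nat.card_Ico, Nat.succ_mul,
    Nat.add_sub_cancel_left]

theorem one_le_votePotential {lam : ℝ} (hlam : 0 ≤ lam) (hn : (d + 1) * N ≤ n)
    (hp : estPrefix x N d = p) :
    1 ≤ votePotential lam p c (plurality x N d) N d n x := by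
  rw [votePotential, if_pos (Or.inr hp), Finset.prod_congr rfl fun i hi =>
    voteFactor_of_lt _ _ _ _ ((Finset.mem_Ico.1 hi).2.trans_le hn),
    ← ENNReal.ofReal_prod_of_nonneg fun i _ => (voteWeight_pos _ _ _ _).le]
  exact ENNReal.one_le_ofReal.2 (one_le_prod_voteWeight_plurality hlam x N d c)

theorem votePotential_succ_le_of_notMem (h : ∀ i < n, x' i = x i)
    (hn : n ∉ Finset.Ico (d * N) ((d + 1) * N)) :
    votePotential lam p c a N d (n + 1) x' ≤ votePotential lam p c a N d n x := by
  rw [votePotential, votePotential, Finset.prod_congr rfl fun i hi =>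
    voteFactor_succ_of_ne lam c a h (ne_of_mem_of_not_mem hi hn)]
  rcases lt_or_ge n (d * N) with hlt | hge
  · rw [if_pos (Or.inl hlt)]
    exact (ite_le_sup _ _ _).trans (sup_le le_rfl zero_le)
  · rw [estPrefix_congr fun i hi => h i (hi.trans_le hge)]
    simp only [hge.not_gt, (hge.trans n.le_succ).not_gt, le_refl]

theorem votePotential_of_mem (hn : n ∈ Finset.Ico (d * N) ((d + 1) * N)) :
    votePotential lam p c a N d n x = if estPrefix x N d = p then
      ENNReal.ofReal (voteRate K lam) *
        ∏ i ∈ (Finset.Ico (d * N) ((d + 1) * N)).erase n, voteFactor lam c a n x i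
      else 0 := by
  simp only [votePotential, (Finset.mem_Ico.1 hn).1.not_gt, false_or]
  rw [← Finset.mul_prod_erase _ _ hn, voteFactor, if_neg n.lt_irrefl]

theorem votePotential_succ_of_mem (h : ∀ i < n, x' i = x i)
    (hn : n ∈ Finset.Ico (d * N) ((d + 1) * N)) :
    votePotential lam p c a N d (n + 1) x' = if estPrefix x N d = p then
      ENNReal.ofReal (voteWeight lam c a (x' n)) *
        ∏ i ∈ (Finset.Ico (d * N) ((d + 1) * N)).erase n, voteFactor lam c a n x i
      else 0 := by
  have hge := (Finset.mem_Ico.1 hn).1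
  simp only [votePotential, (hge.trans n.le_succ).not_gt, false_or]
  rw [estPrefix_congr fun i hi => h i (hi.trans_le hge), ← Finset.mul_prod_erase _ _ hn,
    voteFactor_of_lt _ _ _ _ n.lt_succ_self, Finset.prod_congr rfl fun i hi =>
    voteFactor_succ_of_ne lam c a h (Finset.ne_of_mem_erase hi)]

end Votes

section Tokens

variable {Ω : Type*} {K H n : ℕ} [NeZero K]

/-- The token in a reply to a generator query. -/
def replyToken : Reply (Fin K) K H → Fin K := Sum.elim id fun _ => 0

theorem measurable_replyToken : Measurable (replyToken (K := K) (H := H)) :=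
  measurable_id.sumElim measurable_const

theorem measurable_comp_replyToken (g : Fin K → ℝ≥0∞) :
    Measurable fun o : Reply (Fin K) K H => g (replyToken o) :=
  (Measurable.of_discrete (f := g)).comp measurable_replyToken

/-- The sequence of tokens received in a transcript, continued by zeros. -/
def tokens (r : Algorithm.Transcript Ω (Fin K) K H n) (i : ℕ) : Fin K :=
  if h : i < n then replyToken (r.2 ⟨i, h⟩) else 0

theorem measurable_comp_tokens {α : Type*} [MeasurableSpace Ω] [MeasurableSpace α]
    (F : (ℕ → Fin K) → α) :
    Measurable fun r : Algorithm.Transcript Ω (Fin K) K H n => F (tokens r) := by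
  have hF : Measurable fun y : Fin n → Fin K => F fun i => if h : i < n then y ⟨i, h⟩ else 0 :=
    Measurable.of_discrete
  exact hF.comp (measurable_pi_lambda _ fun i =>
    measurable_replyToken.comp ((measurable_pi_apply i).comp measurable_snd))

theorem tokens_truncate {m : ℕ} (r : Algorithm.Transcript Ω (Fin K) K H n) (hm : m ≤ n) {i : ℕ}
    (hi : i < m) : tokens (Algorithm.truncate hm r) i = tokens r i := by
  rw [tokens, tokens, dif_pos hi, dif_pos (hi.trans_le hm)]
  rfl

theorem tokens_extend_of_lt (r : Algorithm.Transcript Ω (Fin K) K H n) (o : Reply (Fin K) K H)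
    {i : ℕ} (hi : i < n) : tokens (Algorithm.extend r o) i = tokens r i := by
  have h := tokens_truncate (Algorithm.extend r o) n.le_succ hi
  rwa [Algorithm.truncate_extend le_rfl, eq_comm] at h

theorem tokens_extend_self (r : Algorithm.Transcript Ω (Fin K) K H n) (o : Reply (Fin K) K H) :
    tokens (Algorithm.extend r o) n = replyToken o := by
  rw [tokens, dif_pos n.lt_succ_self]
  exact congrArg replyToken (Fin.snoc_last (α := fun _ => Reply (Fin K) K H) o r.2)

theorem lintegral_replyToken {X : Type*} [MeasurableSpace X] (M : Generator X K H)
    (R : Kernel (X × ProbDist (Resp K H)) (Resp K H × ℝ)) (q : X × Prefix K H)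
    (g : Fin K → ℝ≥0∞) :
    ∫⁻ o, g (replyToken o) ∂replyKernel (prefixSample M) R (Sum.inl q) =
      ∑ a, ENNReal.ofReal ((M.next q.1 q.2).1 a) * g a := by
  change ∫⁻ o, g (replyToken o) ∂(massMeasure (M.next q.1 q.2).1).map Sum.inl = _
  rw [lintegral_map (measurable_comp_replyToken g) measurable_inl]
  exact lintegral_massMeasure _ g

end Tokens

section FollowsVotes

variable {Ω X : Type*} [MeasurableSpace Ω] [MeasurableSpace X] {K H N ℓ : ℕ} [NeZero K] {xs : X}
  {A : Algorithm Ω X (X × Prefix K H) (Fin K) K H}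

/-- `A` spends its first `ℓ * N` rounds on draws at the prompt `xs`, with `N` draws at each prefix
formed by the plurality votes of the blocks completed so far. -/
def Algorithm.FollowsVotes (A : Algorithm Ω X (X × Prefix K H) (Fin K) K H) (xs : X) (N ℓ : ℕ) :
    Prop :=
  ∀ n < ℓ * N, ∀ r, ∃ p, A.act n r = Sum.inl (xs, p) ∧ p.1 = estPrefix (tokens r) N (n / N)

theorem Algorithm.FollowsVotes.localReset (hA : A.FollowsVotes xs N ℓ)
    (hlate : ∀ n r q, A.act n r = Sum.inl q → n < ℓ * N) : A.LocalReset := by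
  intro r n x p hact
  have hn := hlate n _ _ hact
  obtain ⟨p', hact', hp⟩ := hA n hn (Algorithm.truncate n.2.le r)
  obtain ⟨rfl, rfl⟩ := Prod.mk.inj (Sum.inl.inj (hact.symm.trans hact'))
  have hN : 0 < N := Nat.pos_of_mul_pos_left (Nat.zero_lt_of_lt hn)
  rcases hk : n.1 / N with _ | k
  · rw [hk] at hp
    exact Or.inl hp
  · have hkn : k * N < n.1 := by
      have := Nat.div_mul_le_self n.1 N
      rw [hk, Nat.succ_mul] at this
      omega
    let m : Fin A.rounds := ⟨k * N, hkn.trans n.2⟩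
    obtain ⟨p₀, hact₀, hp₀⟩ := hA m (hkn.trans hn) (Algorithm.truncate m.2.le r)
    refine Or.inr ⟨m, hkn, p₀, hact₀, Or.inr
      ⟨plurality (tokens (Algorithm.truncate n.2.le r)) N k, ?_⟩⟩
    rw [hp, hk, estPrefix_succ, hp₀, Nat.mul_div_cancel k hN]
    refine congrArg (· ++ _) (estPrefix_congr fun i hi => ?_)
    rw [tokens_truncate r n.2.le (hi.trans hkn), tokens_truncate r m.2.le hi]

variable {M : Generator X K H} {lam : ℝ} {u : List (Fin K)}
  {R : Kernel (X × ProbDist (Resp K H)) (Resp K H × ℝ)} [IsMarkovKernel R]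

theorem lintegral_votePotential_extend_le (hA : A.FollowsVotes xs N u.length)
    (hM : ∀ p, M.next xs p = hiddenPathNext lam u p) {d : ℕ} (hd : d < u.length) {a : Fin K}
    (ha : a ≠ u[d]) (n : ℕ) (r : Algorithm.Transcript Ω (Fin K) K H n) :
    ∫⁻ o, votePotential lam (u.take d) u[d] a N d (n + 1) (tokens (Algorithm.extend r o))
        ∂replyKernel (prefixSample M) R (A.act n r) ≤
      votePotential lam (u.take d) u[d] a N d n (tokens r) := by
  have htok : ∀ o, ∀ i < n, tokens (Algorithm.extend r o) i = tokens r i := fun o _ hi =>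
    tokens_extend_of_lt r o hi
  by_cases hn : n ∈ Finset.Ico (d * N) ((d + 1) * N)
  · obtain ⟨hn1, hn2⟩ := Finset.mem_Ico.1 hn
    obtain ⟨p, hact, hp⟩ := hA n (hn2.trans_le (Nat.mul_le_mul_right N hd)) r
    rw [Nat.div_eq_of_lt_le hn1 hn2] at hp
    simp only [votePotential_succ_of_mem _ _ _ _ (htok _) hn, tokens_extend_self,
      votePotential_of_mem _ _ _ _ hn]
    by_cases hpre : estPrefix (tokens r) N d = u.take d
    · simp only [if_pos hpre]
      rw [lintegral_mul_const _ (measurable_comp_replyToken fun b =>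
        ENNReal.ofReal (voteWeight lam u[d] a b)), hact,
        lintegral_replyToken M R _ fun b => ENNReal.ofReal (voteWeight lam u[d] a b), hM,
        hiddenPathNext_of_eq_take lam (hp.trans hpre) hd, sum_ofReal_tilted_mul_voteWeight lam ha]
    · simp only [if_neg hpre, lintegral_zero, le_refl]
  · refine (lintegral_mono fun o => votePotential_succ_le_of_notMem _ _ _ _ (htok o) hn).trans ?_
    rw [lintegral_const, measure_univ, mul_one]

theorem measure_plurality_eq_le (hlam : 0 ≤ lam) (hA : A.FollowsVotes xs N u.length)
    (hM : ∀ p, M.next xs p = hiddenPathNext lam u p) (hrounds : u.length * N ≤ A.rounds) {d : ℕ}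
    (hd : d < u.length) {a : Fin K} (ha : a ≠ u[d]) :
    A.law (prefixSample M) R
        {r | estPrefix (tokens r) N d = u.take d ∧ plurality (tokens r) N d = a} ≤
      ENNReal.ofReal (voteRate K lam) ^ N := by
  set V := fun n (r : Algorithm.Transcript Ω (Fin K) K H n) =>
    votePotential lam (u.take d) u[d] a N d n (tokens r)
  have hV : ∀ n, Measurable (V n) := fun n => measurable_comp_tokens _
  calc A.law (prefixSample M) R
        {r | estPrefix (tokens r) N d = u.take d ∧ plurality (tokens r) N d = a}
      ≤ A.law (prefixSample M) R {r | 1 ≤ V A.rounds r} := by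
        refine measure_mono ?_
        rintro r ⟨hp, rfl⟩
        exact one_le_votePotential _ _ hlam ((Nat.mul_le_mul_right N hd).trans hrounds) hp
    _ ≤ ∫⁻ r, V A.rounds r ∂A.law (prefixSample M) R := by
        simpa only [one_mul] using mul_meas_ge_le_lintegral (hV A.rounds) 1
    _ ≤ ∫⁻ r, V 0 r ∂A.lawUpTo (prefixSample M) R 0 :=
        A.lintegral_lawUpTo_le_of_supermartingale _ _ V hV fun n _ r =>
          lintegral_votePotential_extend_le hA hM hd ha n r
    _ ≤ ∫⁻ _, ENNReal.ofReal (voteRate K lam) ^ N ∂A.lawUpTo (prefixSample M) R 0 :=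
        lintegral_mono fun r => votePotential_zero_le _ _ _ _ _
    _ = ENNReal.ofReal (voteRate K lam) ^ N := by rw [lintegral_const, measure_univ, mul_one]

theorem measure_estPrefix_ne_le (hlam : 0 ≤ lam) (hA : A.FollowsVotes xs N u.length)
    (hM : ∀ p, M.next xs p = hiddenPathNext lam u p) (hrounds : u.length * N ≤ A.rounds) :
    A.law (prefixSample M) R {r | estPrefix (tokens r) N u.length ≠ u} ≤
      u.length * (K * ENNReal.ofReal (voteRate K lam) ^ N) := by
  set P := A.law (prefixSample M) R
  set E := fun (d : Fin u.length) (a : Fin K) => {r : Algorithm.Transcript Ω (Fin K) K H A.rounds |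
    a ≠ u[d] ∧ estPrefix (tokens r) N d = u.take d ∧ plurality (tokens r) N d = a}
  have hsub : {r | estPrefix (tokens r) N u.length ≠ u} ⊆ ⋃ d, ⋃ a, E d a := by
    intro r hr
    obtain ⟨d, hd, hpre, herr⟩ := exists_first_error le_rfl (by rwa [List.take_length])
    exact Set.mem_iUnion₂.2 ⟨⟨d, hd⟩, _, herr, hpre, rfl⟩
  have hE : ∀ d a, P (E d a) ≤ ENNReal.ofReal (voteRate K lam) ^ N := fun d a => by
    by_cases ha : a = u[d]
    · simp only [E, ne_eq, ha, not_true_eq_false, false_and, Set.ofPred_false, measure_empty,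
        zero_le]
    · exact (measure_mono fun r hr => hr.2).trans
        (measure_plurality_eq_le hlam hA hM hrounds d.2 ha)
  calc P {r | estPrefix (tokens r) N u.length ≠ u}
      ≤ ∑ d, ∑ a, P (E d a) := (measure_mono hsub).trans <|
        (measure_iUnion_fintype_le _ _).trans <|
          Finset.sum_le_sum fun d _ => measure_iUnion_fintype_le _ _
    _ ≤ ∑ _d : Fin u.length, ∑ _a : Fin K, ENNReal.ofReal (voteRate K lam) ^ N :=
        Finset.sum_le_sum fun d _ => Finset.sum_le_sum fun a _ => hE d a
    _ = u.length * (K * ENNReal.ofReal (voteRate K lam) ^ N) := by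
        simp only [Finset.sum_const, Finset.card_univ, Fintype.card_fin, nsmul_eq_mul]

end FollowsVotes

/-! ### The local-reset learner -/

section GeneralAlgorithms

variable {Ω X GQ GR : Type*} [MeasurableSpace Ω] [MeasurableSpace X] [MeasurableSpace GQ]
  [MeasurableSpace GR] {K H : ℕ} {A : Algorithm Ω X GQ GR K H}

theorem Algorithm.usesAtMost_of_act {g : ℕ} (hgen : ∀ n r q, A.act n r = Sum.inl q → n < g)
    (hreward : ∀ n r a, A.act n r = Sum.inr (Sum.inl a) → n = g) : A.UsesAtMost g 1 := by
  refine fun r => ⟨?_, ?_⟩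
  · have hlt : ∀ n : {n : Fin A.rounds // ∃ q, A.actionAt r n = Sum.inl q}, n.1.1 < g :=
      fun ⟨n, _, hq⟩ => hgen n _ _ hq
    have hinj : Function.Injective fun n => (⟨n.1.1, hlt n⟩ : Fin g) := fun m n h =>
      Subtype.ext (Fin.ext (Fin.mk.inj h))
    exact (Nat.card_le_card_of_injective _ hinj).trans_eq (Nat.card_fin g)
  · refine Finite.card_le_one_iff_subsingleton.2 ⟨fun ⟨m, _, hm⟩ ⟨n, _, hn⟩ => ?_⟩
    exact Subtype.ext (Fin.ext ((hreward m _ _ hm).trans (hreward n _ _ hn).symm))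

theorem Algorithm.lawUpTo_succ_eq_zero {G : Kernel GQ GR}
    {R : Kernel (X × ProbDist (Resp K H)) (Resp K H × ℝ)} [IsMarkovKernel G] [IsMarkovKernel R]
    {n : ℕ} {S : Set (Transcript Ω GR K H (n + 1))} (hS : MeasurableSet S)
    (h : ∀ r, replyKernel G R (A.act n r) {o | extend r o ∈ S} = 0) :
    A.lawUpTo G R (n + 1) S = 0 := by
  rw [← lintegral_indicator_one hS, A.lintegral_lawUpTo_succ G R (measurable_one.indicator hS)]
  refine (lintegral_congr fun r => ?_).trans lintegral_zero
  exact (lintegral_indicator_one (measurable_extend r hS)).trans (h r)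

end GeneralAlgorithms

section PointMass

variable {X GQ GR : Type*} [MeasurableSpace X] [MeasurableSpace GQ] [MeasurableSpace GR] {K H : ℕ}

open scoped Classical in
/-- The distribution concentrated at `z`, used for reward queries with a prescribed completion. -/
def pointMass {α : Type*} [Fintype α] (z : α) : ProbDist α :=
  ⟨Pi.single z 1, single_mem_stdSimplex ℝ z⟩

theorem rewardOracle_pointMass (I : Instance X K H) (x : X) (z : Resp K H) :
    rewardOracle I (x, pointMass z) = Measure.dirac (z, I.reward x z) := by
  classical
  change ∑ y, ENNReal.ofReal ((pointMass z).1 y) • Measure.dirac (y, I.reward x y) = _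
  rw [Finset.sum_eq_single z (fun y _ hy => by simp [pointMass, hy]) (by simp)]
  simp [pointMass]

theorem replyKernel_pointMass (G : Kernel GQ GR) (I : Instance X K H) (x : X) (z : Resp K H) :
    replyKernel G (rewardOracle I) (Sum.inr (Sum.inl (x, pointMass z))) =
      Measure.dirac (Sum.inr (Sum.inl (z, I.reward x z))) := by
  change (rewardOracle I (x, pointMass z)).map _ = _
  rw [rewardOracle_pointMass, Measure.map_dirac' measurable_inr_inl_reply]

end PointMass

section ReplyBit

variable {GR : Type*} {K H : ℕ}

open scoped Classical in
/-- The reward bit inferred from the reply to a reward query at the target for the bit `false`: it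
is `true` exactly when no reward is paid. -/
def replyBit : Reply GR K H → Bool :=
  Sum.elim (fun _ => false) (Sum.elim (fun o => decide (o.2 = 0)) fun _ => false)

theorem measurable_replyBit [MeasurableSpace GR] :
    Measurable (replyBit (GR := GR) (K := K) (H := H)) := by
  classical
  have h : Measurable fun o : Resp K H × ℝ => decide (o.2 = 0) :=
    measurable_to_bool (by simpa [Set.preimage] using measurable_snd (measurableSet_singleton 0))
  exact measurable_const.sumElim (h.sumElim measurable_const)

end ReplyBit

section LearnerAct

variable {X : Type*} {K D L N : ℕ} [NeZero K]

/-- The suffix read off the plurality votes of the last `L` blocks. -/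
def estSuffix (x : ℕ → Fin K) (N D L : ℕ) (i : Fin L) : Fin K := plurality x N (D + i)

theorem estSuffix_congr {x x' : ℕ → Fin K} (h : ∀ i < (D + L) * N, x i = x' i) :
    estSuffix x N D L = estSuffix x' N D L :=
  funext fun j => plurality_congr fun i hi =>
    h i (hi.trans_le (Nat.mul_le_mul_right N (by omega)))

theorem estSuffix_eq_of_estPrefix_eq {x : ℕ → Fin K} {v : Fin D → Fin K} {s : Fin L → Fin K}
    (h : estPrefix x N (D + L) = List.ofFn v ++ List.ofFn s) : estSuffix x N D L = s := by
  funext i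
  have hi := congrArg (fun l : List (Fin K) => l[D + i.1]?) h
  simpa [estPrefix, estSuffix, List.getElem?_append_right] using hi

theorem length_estPrefix_div_lt (x : ℕ → Fin K) {n : ℕ} (h : n < (D + L) * N) :
    (estPrefix x N (n / N)).length < D + L + 1 := by
  rw [length_estPrefix]
  exact (Nat.div_lt_of_lt_mul (by rwa [mul_comm N])).trans (Nat.lt_succ_self _)

/-- The action of the learner in round `n`, given the tokens seen so far: `N` draws at each of the
`D + L` prefixes of plurality votes, then one reward query at the inferred target for the bit
`false`. -/
def learnerAct (xs : X) (v : Fin D → Fin K) (τ : Bool → Fin K) (N n : ℕ) (x : ℕ → Fin K) :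
    Action X (X × Prefix K (D + L + 1)) K (D + L + 1) :=
  if h : n < (D + L) * N then
    Sum.inl (xs, toPrefix (estPrefix x N (n / N)) (length_estPrefix_div_lt x h))
  else if n = (D + L) * N then
    Sum.inr (Sum.inl (xs, pointMass (target v τ (estSuffix x N D L) false)))
  else Sum.inr (Sum.inr ())

theorem lt_of_learnerAct_eq_inl {xs : X} {v : Fin D → Fin K} {τ : Bool → Fin K} {n : ℕ}
    {x : ℕ → Fin K} {q : X × Prefix K (D + L + 1)}
    (h : learnerAct (L := L) xs v τ N n x = Sum.inl q) : n < (D + L) * N := by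
  rw [learnerAct] at h
  split_ifs at h with hn
  exact hn

theorem eq_of_learnerAct_eq_inr_inl {xs : X} {v : Fin D → Fin K} {τ : Bool → Fin K} {n : ℕ}
    {x : ℕ → Fin K} {a : X × ProbDist (Resp K (D + L + 1))}
    (h : learnerAct (L := L) xs v τ N n x = Sum.inr (Sum.inl a)) : n = (D + L) * N := by
  rw [learnerAct] at h
  split_ifs at h with _ hn
  · exact hn
  · simp at h

end LearnerAct

section InferredParameters

variable {K D L H : ℕ} [NeZero K] (N : ℕ)

/-- The suffix and the reward bit inferred from the transcript of the learner. -/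
def inferredParameters (r : Algorithm.Transcript Unit (Fin K) K H ((D + L) * N + 1)) :
    (Fin L → Fin K) × Bool :=
  (estSuffix (tokens r) N D L, replyBit (r.2 (Fin.last _)))

theorem measurable_inferredParameters :
    Measurable (inferredParameters (K := K) (D := D) (L := L) (H := H) N) :=
  (measurable_comp_tokens fun x => estSuffix x N D L).prodMk
    (measurable_replyBit.comp ((measurable_pi_apply _).comp measurable_snd))

theorem inferredParameters_extend (r : Algorithm.Transcript Unit (Fin K) K H ((D + L) * N))
    (o : Reply (Fin K) K H) :
    inferredParameters N (Algorithm.extend r o) =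
      ((estSuffix (tokens r) N D L : Fin L → Fin K), replyBit o) :=
  Prod.ext (estSuffix_congr fun _ => tokens_extend_of_lt r o)
    (congrArg replyBit (Fin.snoc_last (α := fun _ => Reply (Fin K) K H) o r.2) :)

end InferredParameters

section Learner

variable {X : Type*} [MeasurableSpace X] {K D L : ℕ} [NeZero K] (xs : X) (v : Fin D → Fin K)
  (τ : Bool → Fin K) (N : ℕ) (π : (Fin L → Fin K) × Bool → Policy X K (D + L + 1))

/-- The learner: it votes its way down the hidden path, spends its one reward query on the inferred
target for the bit `false`, and outputs the policy that `π` assigns to the inferred parameters. -/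
def learner : Algorithm Unit X (X × Prefix K (D + L + 1)) (Fin K) K (D + L + 1) where
  seedLaw := Measure.dirac ()
  isProbabilityMeasure_seedLaw := inferInstance
  rounds := (D + L) * N + 1
  act n r := learnerAct xs v τ N n (tokens r)
  measurable_act _ := measurable_comp_tokens _
  output r := (π (inferredParameters N r.1)).resp r.2
  measurable_output := by
    have hresp : Measurable fun p : ((Fin L → Fin K) × Bool) × X => (π p.1).resp p.2 :=
      measurable_from_prod_countable_right fun i => (π i).measurable_resp
    exact hresp.comp (((measurable_inferredParameters N).comp measurable_fst).prodMk measurable_snd)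

theorem learner_followsVotes : (learner xs v τ N π).FollowsVotes xs N (D + L) :=
  fun _ hn _ => ⟨_, dif_pos hn, rfl⟩

theorem learner_usesAtMost : (learner xs v τ N π).UsesAtMost ((D + L) * N) 1 :=
  Algorithm.usesAtMost_of_act (fun _ _ _ => lt_of_learnerAct_eq_inl)
    fun _ _ _ => eq_of_learnerAct_eq_inr_inl

theorem learner_localReset : (learner xs v τ N π).LocalReset :=
  (learner_followsVotes xs v τ N π).localReset fun _ _ _ => lt_of_learnerAct_eq_inl

variable {xs} {β : ℝ} (lam : ℝ) (hxs : MeasurableSet {xs}) (easy : Generator X K (D + L + 1))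
  (s : Fin L → Fin K) (b : Bool)

theorem rewardScale_pos (K D L : ℕ) [NeZero K] (lam : ℝ) (hβ : 0 < β) :
    0 < rewardScale K D L lam β := by
  refine mul_pos hβ (Real.log_pos ((one_lt_div (targetMass_pos K D L lam)).2 ?_))
  linarith [targetMass_le_one K D L lam]

theorem replyBit_hardInstance_reward {GR : Type*} (hβ : 0 < β) (hτ : τ false ≠ τ true)
    (z : Resp K (D + L + 1)) :
    replyBit (Sum.inr (Sum.inl (z, (hardInstance lam β hxs easy v τ s b).reward xs
      (target v τ s false))) : Reply GR K (D + L + 1)) = b := by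
  cases b with
  | false => simp [replyBit, hardInstance, (rewardScale_pos K D L lam hβ).ne']
  | true =>
    have hne : target v τ s false ≠ target v τ s true := fun h => hτ (by
      simpa [target] using congrFun h (Fin.last _))
    simp [replyBit, hardInstance, hne]

theorem law_learner_snd_inferredParameters_ne (hβ : 0 < β) (hτ : τ false ≠ τ true)
    (G : Kernel (X × Prefix K (D + L + 1)) (Fin K)) [IsMarkovKernel G] :
    (learner xs v τ N π).law G (rewardOracle (hardInstance lam β hxs easy v τ s b))
      {r | (inferredParameters N r).1 = s ∧ (inferredParameters N r).2 ≠ b} = 0 := by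
  have hS : MeasurableSet {r : Algorithm.Transcript Unit (Fin K) K (D + L + 1) ((D + L) * N + 1) |
      (inferredParameters N r).1 = s ∧ (inferredParameters N r).2 ≠ b} :=
    measurable_inferredParameters N
      (MeasurableSet.of_discrete (s := {i : (Fin L → Fin K) × Bool | i.1 = s ∧ i.2 ≠ b}))
  refine Algorithm.lawUpTo_succ_eq_zero hS fun r => ?_
  have hact : (learner xs v τ N π).act ((D + L) * N) r = Sum.inr (Sum.inl
      (xs, pointMass (target v τ (estSuffix (tokens r) N D L) false))) :=
    (dif_neg (lt_irrefl _)).trans (if_pos rfl)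
  rw [hact, replyKernel_pointMass]
  refine (Measure.dirac_apply' _ (Algorithm.measurable_extend r hS)).trans
    (Set.indicator_of_notMem ?_ _)
  rintro ⟨hs, hb⟩
  rw [inferredParameters_extend] at hs hb
  refine hb ?_
  change estSuffix (tokens r) N D L = s at hs
  rw [hs]
  exact replyBit_hardInstance_reward (GR := Fin K) v τ lam hxs easy s b hβ hτ _

theorem le_law_learner_policy_eq (hK : 2 ≤ K) (hlam : 0 ≤ lam) (hβ : 0 < β)
    (hτ : τ false ≠ τ true) :
    1 - (D + L : ℕ) * (K * voteRate K lam ^ N) ≤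
      ((learner xs v τ N π).law (prefixSample (hardGenerator lam hxs easy v s))
        (rewardOracle (hardInstance lam β hxs easy v τ s b))).real
      {r | (learner xs v τ N π).policy r = π (s, b)} := by
  set P := (learner xs v τ N π).law (prefixSample (hardGenerator lam hxs easy v s))
    (rewardOracle (hardInstance lam β hxs easy v τ s b))
  set good := {r | (learner xs v τ N π).policy r = π (s, b)}
  set u := List.ofFn v ++ List.ofFn s
  have hu : u.length = D + L := by simp only [u, List.length_append, List.length_ofFn]
  have hsub : goodᶜ ⊆ {r | estPrefix (tokens r) N u.length ≠ u} ∪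
      {r | (inferredParameters N r).1 = s ∧ (inferredParameters N r).2 ≠ b} := fun r hr => by
    by_cases hpath : estPrefix (tokens r) N u.length = u
    · have hs := estSuffix_eq_of_estPrefix_eq (hu ▸ hpath)
      refine Or.inr ⟨hs, fun hb => hr ?_⟩
      have hparams : inferredParameters N r = (s, b) := Prod.ext hs hb
      exact congrArg π hparams
    · exact Or.inl hpath
  have hpath : P {r | estPrefix (tokens r) N u.length ≠ u} ≤
      u.length * (K * ENNReal.ofReal (voteRate K lam) ^ N) :=
    measure_estPrefix_ne_le hlam (by rw [hu]; exact learner_followsVotes xs v τ N π)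
      (hardGenerator_next_hard lam hxs easy v s) (by rw [hu]; exact Nat.le_succ _)
  have hbad : P goodᶜ ≤ u.length * (K * ENNReal.ofReal (voteRate K lam) ^ N) := by
    refine (measure_mono hsub).trans ((measure_union_le _ _).trans ?_)
    rwa [law_learner_snd_inferredParameters_ne v τ N π lam hxs easy s b hβ hτ, add_zero]
  have hreal : P.real goodᶜ ≤ (D + L : ℕ) * (K * voteRate K lam ^ N) := by
    simpa only [measureReal_def, hu, ENNReal.toReal_mul, ENNReal.toReal_pow,
      ENNReal.toReal_natCast, ENNReal.toReal_ofReal (voteRate_pos hK lam).le] using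
      ENNReal.toReal_mono (by finiteness) hbad
  have hone : 1 ≤ P.real good + P.real goodᶜ := by
    simpa only [Set.union_compl_self, probReal_univ] using
      measureReal_union_le (μ := P) good goodᶜ
  linarith

end Learner

/-! ### Quantitative bounds -/

theorem exists_nat_pow_le {r ε : ℝ} (hr : 0 < r) (hr1 : r < 1) (hε : 0 < ε) (hε1 : ε ≤ 1) :
    ∃ N : ℕ, r ^ N ≤ ε ∧ (N : ℝ) ≤ Real.log ε⁻¹ / Real.log r⁻¹ + 1 := by
  have hlog : 0 < Real.log r⁻¹ := Real.log_pos ((one_lt_inv₀ hr).2 hr1)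
  have hratio : 0 ≤ Real.log ε⁻¹ / Real.log r⁻¹ :=
    div_nonneg (Real.log_nonneg ((one_le_inv₀ hε).2 hε1)) hlog.le
  refine ⟨⌈Real.log ε⁻¹ / Real.log r⁻¹⌉₊, ?_, (Nat.ceil_lt_add_one hratio).le⟩
  have hceil := (div_le_iff₀ hlog).1 (Nat.le_ceil (Real.log ε⁻¹ / Real.log r⁻¹))
  rw [← Real.log_le_log_iff (pow_pos hr _) hε, Real.log_pow]
  rw [Real.log_inv, Real.log_inv] at hceil ⊢
  linarith

/-- The constant `C` such that `C log (H / δ)` draws per prefix make all `H` plurality votes correct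
with probability at least `1 - δ`. -/
def sampleConstant (K : ℕ) (lam : ℝ) : ℝ := (1 + Real.log K) / Real.log (voteRate K lam)⁻¹ + 1

theorem sampleConstant_pos {K : ℕ} (hK : 2 ≤ K) {lam : ℝ} (hlam : 0 < lam) :
    0 < sampleConstant K lam := by
  have hlog : 0 < Real.log (voteRate K lam)⁻¹ :=
    Real.log_pos ((one_lt_inv₀ (voteRate_pos hK lam)).2 (voteRate_lt_one hK hlam))
  have := Real.log_natCast_nonneg K
  unfold sampleConstant
  positivity

theorem exists_blockLength {K : ℕ} (hK : 2 ≤ K) {lam : ℝ} (hlam : 0 < lam) {h δ : ℝ} (hh : 3 ≤ h)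
    (hδ : 0 < δ) (hδ1 : δ ≤ 1) :
    ∃ N : ℕ, h * (K * voteRate K lam ^ N) ≤ δ ∧ N ≤ sampleConstant K lam * Real.log (h / δ) := by
  have hr := voteRate_pos hK lam
  have hr1 := voteRate_lt_one hK hlam
  have hlogr : 0 < Real.log (voteRate K lam)⁻¹ := Real.log_pos ((one_lt_inv₀ hr).2 hr1)
  have hK1 : (1 : ℝ) ≤ K := by exact_mod_cast (by omega : 1 ≤ K)
  have hlogK : 0 ≤ Real.log K := Real.log_natCast_nonneg K
  have hratio : 3 ≤ h / δ := hh.trans (le_div_self (by linarith) hδ hδ1)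
  have hlog : 1 ≤ Real.log (h / δ) := by
    rw [Real.le_log_iff_exp_le (by linarith)]
    linarith [Real.exp_one_lt_d9]
  obtain ⟨N, hpow, hN⟩ := exists_nat_pow_le hr hr1 (ε := (K * (h / δ))⁻¹) (by positivity)
    (inv_le_one_of_one_le₀ (one_le_mul_of_one_le_of_one_le hK1 (by linarith)))
  rw [inv_inv, Real.log_mul (by positivity) (by positivity)] at hN
  refine ⟨N, ?_, hN.trans ?_⟩
  · calc h * (K * voteRate K lam ^ N) ≤ h * (K * (K * (h / δ))⁻¹) := by gcongr
      _ = δ := by field_simp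
  · rw [sampleConstant, add_mul, one_mul, div_mul_eq_mul_div]
    gcongr
    nlinarith

theorem sqrt_div_mul_inv_sqrt_pow_le {p x : ℝ} (hp : 0 < p) (hp1 : p ≤ 1) {D H : ℕ}
    (hH : H ≤ 2 * D + 1) (hx : 1 / 3 ≤ x * p ^ D) : √p / 3 * (√p)⁻¹ ^ H ≤ x := by
  have hsqrt : 0 < √p := Real.sqrt_pos.2 hp
  calc √p / 3 * (√p)⁻¹ ^ H ≤ √p / 3 * (√p)⁻¹ ^ (2 * D + 1) := by
        gcongr
        exact (one_le_inv₀ hsqrt).2 (Real.sqrt_le_one.2 hp1)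
    _ = 1 / 3 / p ^ D := by
        rw [pow_succ, pow_mul, inv_pow, Real.sq_sqrt hp.le, inv_pow]
        field_simp
    _ ≤ x := (div_le_iff₀ (pow_pos hp D)).2 hx

theorem le_pow_of_two_le {K L n : ℕ} (hK : 2 ≤ K) (hn : n ≤ L) : (n : ℝ) ≤ (K : ℝ) ^ L := by
  exact_mod_cast hn.trans (Nat.lt_pow_self (by omega)).le

/-! ### The two access regimes -/

section Separation

variable {X : Type*} [MeasurableSpace X] {ρ : Measure X} [IsFiniteMeasure ρ] {K D L : ℕ} [NeZero K]
  {lam β : ℝ} (hK : 2 ≤ K) (hlam : 0 < lam) (hβ : 0 < β) {xs : X} (hxs : MeasurableSet {xs})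
  (easy : Generator X K (D + L + 1)) (v : Fin D → Fin K) {τ : Bool → Fin K}

include hK hlam hβ in
theorem exists_localReset_isOptimizer (hτ : τ false ≠ τ true) (hDL : 2 ≤ D + L) {δ : ℝ}
    (hδ : 0 < δ) (hδ1 : δ ≤ 1) :
    ∃ g : ℕ, (g : ℝ) ≤ sampleConstant K lam *
      ((D + L + 1 : ℕ) * Real.log ((D + L + 1 : ℕ) / δ)) ∧
    ∃ A : Algorithm Unit X (X × Prefix K (D + L + 1)) (Fin K) K (D + L + 1),
      A.UsesAtMost g 1 ∧ A.LocalReset ∧ ∀ (s : Fin L → Fin K) (b : Bool),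
        1 - δ ≤ (A.law (prefixSample (hardGenerator lam hxs easy v s))
          (rewardOracle (hardInstance lam β hxs easy v τ s b))).real
          {r | (hardInstance lam β hxs easy v τ s b).IsOptimizer ρ β (A.policy r)} := by
  have hH : (3 : ℝ) ≤ (D + L + 1 : ℕ) := by exact_mod_cast (by omega : 3 ≤ D + L + 1)
  have hle : ((D + L : ℕ) : ℝ) ≤ (D + L + 1 : ℕ) := by exact_mod_cast Nat.le_succ _
  obtain ⟨N, hδN, hN⟩ := exists_blockLength hK hlam hH hδ hδ1
  let π (i : (Fin L → Fin K) × Bool) : Policy X K (D + L + 1) :=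
    (hardInstance lam β hxs easy v τ i.1 i.2).tiltedPolicy β hxs
  refine ⟨(D + L) * N, ?_, learner xs v τ N π, learner_usesAtMost xs v τ N π,
    learner_localReset xs v τ N π, fun s b => ?_⟩
  · calc (((D + L) * N : ℕ) : ℝ) = (D + L : ℕ) * N := Nat.cast_mul ..
      _ ≤ (D + L + 1 : ℕ) * (sampleConstant K lam * Real.log ((D + L + 1 : ℕ) / δ)) := by gcongr
      _ = _ := by ring
  · have hopt : (hardInstance lam β hxs easy v τ s b).IsOptimizer ρ β (π (s, b)) :=
      Instance.isOptimizer_tiltedPolicy _ hβ hxs fun _ hx y =>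
        hardInstance_reward_of_ne lam β hxs easy v τ s b hx y
    have hfail : ((D + L : ℕ) : ℝ) * (K * voteRate K lam ^ N) ≤ δ := by
      have := (voteRate_pos hK lam).le
      exact (by gcongr : _ ≤ _).trans hδN
    refine ((sub_le_sub_left hfail 1).trans (le_law_learner_policy_eq v τ N π lam hxs easy s b hK
      hlam.le hβ hτ)).trans (measureReal_mono fun r hr => ?_)
    exact (congrArg ((hardInstance lam β hxs easy v τ s b).IsOptimizer ρ β) hr).mpr hopt

include hβ in
theorem sqrt_pPlus_mul_pow_le_of_noReset {Q Y Ω : Type*} [MeasurableSpace Q] [MeasurableSpace Y]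
    [MeasurableSpace Ω] {qg qr : ℕ} (hη : 0 < ρ.real {xs}) (hLD : L ≤ D)
    (hL : 3 * (4 + qr) ≤ (K : ℝ) ^ L)
    (Γ : Kernel (X × Q × Resp K (D + L + 1) × (Fin (D + L + 1) → ProbDist (Fin K))) Y)
    [IsMarkovKernel Γ] {A : Algorithm Ω X (X × Q) Y K (D + L + 1)} (hA : A.UsesAtMost qg qr)
    {b : Bool}
    (hs : ∀ s : Fin L → Fin K, 2 / 3 ≤ (A.law (noReset Γ (hardGenerator lam hxs easy v s))
        (rewardOracle (hardInstance lam β hxs easy v τ s b))).real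
        {r | (hardInstance lam β hxs easy v τ s b).regret ρ β (A.policy r) ≤
          ((ρ.real {xs} * β / 4 : ℝ) : EReal)}) :
    √(pPlus K lam) / 3 * (√(pPlus K lam))⁻¹ ^ (D + L + 1) ≤ qg := by
  refine sqrt_div_mul_inv_sqrt_pow_le (pPlus_pos lam) (pPlus_le_one lam) (D := D) (by omega) ?_
  have := Nat.cast_nonneg (α := ℝ) qr
  have hKL : 0 < (K : ℝ) ^ L := by linarith
  have hcount := two_thirds_mul_pow_le_of_noReset lam β hxs easy v τ b hβ hη Γ hA hs
  refine le_of_mul_le_mul_left ?_ hKL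
  linarith

end Separation

end GenAccess

end

theorem corollary4 (K : ℕ) [NeZero K] (hK : 2 ≤ K) (lam : ℝ) (hlam : 0 < lam) :
    ∃ c : ℝ, 1 < c ∧ ∃ C : ℝ, 0 < C ∧ ∃ a : ℝ, 0 < a ∧
    ∀ β : ℝ, 0 < β → ∀ qr : ℕ, 1 ≤ qr →
    ∃ H₀ : ℕ, ∀ H : ℕ, H₀ ≤ H →
    ∃ D L : ℕ, 1 ≤ D ∧ 1 ≤ L ∧ D + L + 1 = H ∧
    ∀ (X : Type*) [MeasurableSpace X] (ρ : Measure X) [IsProbabilityMeasure ρ]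
      (xs : X) (hxs : MeasurableSet {xs}), 0 < ρ.real {xs} →
    ∀ (easy : Generator X K (D + L + 1)) (v : Fin D → Fin K) (τ : Bool → Fin K),
      τ false ≠ τ true →
    -- chosen-prefix next-token sampling, under the local-reset discipline
    (∀ δ : ℝ, 0 < δ → δ < 1 →
      ∃ g : ℕ, (g : ℝ) ≤ C * (H * Real.log (H / δ)) ∧
      ∃ (Ω : Type) (_ : MeasurableSpace Ω)
        (A : Algorithm Ω X (X × Prefix K (D + L + 1)) (Fin K) K (D + L + 1)),
        A.UsesAtMost g 1 ∧ A.LocalReset ∧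
        ∀ (s : Fin L → Fin K) (b : Bool),
          let I := hardInstance lam β hxs easy v τ s b
          1 - δ ≤ (A.law (prefixSample I.base) (rewardOracle I)).real
            {run | I.IsOptimizer ρ β (A.policy run)}) ∧
    -- no-reset access
    (∀ (Q Y : Type*) [MeasurableSpace Q] [MeasurableSpace Y]
      (Γ : Kernel (X × Q × Resp K (D + L + 1) × (Fin (D + L + 1) → ProbDist (Fin K))) Y)
      [IsMarkovKernel Γ]
      (Ω : Type*) [MeasurableSpace Ω] (A : Algorithm Ω X (X × Q) Y K (D + L + 1)) (qg : ℕ),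
      A.UsesAtMost qg qr →
      (∀ (s : Fin L → Fin K) (b : Bool),
        let I := hardInstance lam β hxs easy v τ s b
        2 / 3 ≤ (A.law (noReset Γ I.base) (rewardOracle I)).real
          {run | I.regret ρ β (A.policy run) ≤ ((ρ.real {xs} * β / 4 : ℝ) : EReal)}) →
      a * c ^ H ≤ (qg : ℝ)) := by
  have hp := Real.sqrt_pos.2 (pPlus_pos (K := K) lam)
  have hp1 : √(pPlus K lam) < 1 := (Real.sqrt_lt_sqrt (pPlus_pos lam).le
    (pPlus_lt_one hK lam)).trans_eq Real.sqrt_one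
  refine ⟨(√(pPlus K lam))⁻¹, (one_lt_inv₀ hp).2 hp1, sampleConstant K lam,
    sampleConstant_pos hK hlam, √(pPlus K lam) / 3, by positivity, fun β hβ qr _ =>
    ⟨2 * (3 * (4 + qr)) + 4, fun H hH => ?_⟩⟩
  obtain ⟨D, L, hLD, hL, rfl⟩ : ∃ D L : ℕ, L ≤ D ∧ 3 * (4 + qr) ≤ L ∧ H = D + L + 1 :=
    ⟨H / 2, H - 1 - H / 2, by omega, by omega, by omega⟩
  refine ⟨D, L, by omega, by omega, rfl, fun X _ ρ _ xs hxs hη easy v τ hτ => ⟨fun δ hδ hδ1 => ?_,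
    fun Q Y _ _ Γ _ Ω _ A qg hA hs => ?_⟩⟩
  · obtain ⟨g, hg, A, hA⟩ := exists_localReset_isOptimizer (ρ := ρ) hK hlam hβ hxs easy v hτ
      (by omega) hδ hδ1.le
    exact ⟨g, hg, Unit, inferInstance, A, hA⟩
  · have hKL : 3 * (4 + (qr : ℝ)) ≤ (K : ℝ) ^ L := by exact_mod_cast le_pow_of_two_le hK hL
    exact sqrt_pPlus_mul_pow_le_of_noReset hβ hxs easy v hη hLD hKL Γ hA fun s => hs s false
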